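/- **Setting.** Let $n\ge 2$, $1\le k\le n$, $P\ge 0$, $d\ge 7$ be integers, $c\ge1$ an integer constant, and $m'=ck$. Choose a bipartite graph uniformly at random among those with $n$ left nodes, $m'$ right nodes and every left node of degree $d$; let $N(j)$ be the neighbourhood of the left node $j$. For every edge $(i,j)$ choose independently a phase $\theta_{ij}$ uniformly from the $2^{3\lceil\log_2 k\rceil}$ equally spaced points $\frac{\pi}{2}\,t\,2^{-3\lceil\log_2 k\rceil}$, $0\le t<2^{3\lceil\log_2 k\rceil}$, of $[0,\pi/2)$. The random matrix $A\in\mathbb C^{m\times n}$ has $m=2m'=2ck$ rows: each right node $i$ has an identification row and a verification row, whose entries in column $j\in\{1,\dots,n\}$ are $a^{(I)}_{ij}=e^{\iota j\pi/(2n)}$ and $a^{(V)}_{ij}=e^{\iota\theta_{ij}}$ if $i\in N(j)$, and $0$ otherwise. **Decoder SHO-FA.** It knows $A$ and is given $y=(y^{(I)},y^{(V)})\in\mathbb C^m$. It keeps residuals $\tilde y^{(I)},\tilde y^{(V)}$ (initially $y^{(I)},y^{(V)}$), an estimate $\hat x$ (initially $0$) and a set $L$ of right nodes. A right node $i$ passes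 the leaf test if $\tilde y^{(I)}_i\ne0$; the number $j=\frac{2n}{\pi}\,\angle\tilde y^{(I)}_i$, with the phase taken modulo $\pi$, is an integer in $\{1,\dots,n\}$ with $i\in N(j)$; and $v=\tilde y^{(I)}_i/a^{(I)}_{ij}$ satisfies $a^{(V)}_{ij}v=\tilde y^{(V)}_i$. Initially $L$ is the set of nodes that pass. Then, at most $k$ times and while $L\neq\emptyset$, the decoder picks some $i\in L$, removes it, sets $\hat x_j=v$ for the $j,v$ found by the test, subtracts $v\,a^{(I)}_{i'j}$ and $v\,a^{(V)}_{i'j}$ from the residuals at all $i'\in N(j)$, and retests the nodes $i'\in N(j)\setminus\{i\}$, adding them to or removing them from $L$. The rule for picking from $L$ may be any function of the iteration number and of $L$, fixed independently of $A$ (hence also any random rule independent of $A$, such as the uniform one). The decoder is run either in exact real arithmetic, or in fixed-point arithmetic with $s$ bits before and $s$ bits after the binary point and tolerance $\tau$: the input, the entries of $A$ and the result of every operation (for complex numbers, the real and the imaginary part) are rounded to the nearest multiple of $2^{-s}$ in $[-2^s,2^s]$, the phase quotient above is rounded to the nearest integer $j$, $v$ is replaced by its real part, and the tests "$=0$", "is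 an integer" and "is equal" are passed when the discrepancy is at most $\tau$. A step is one memory access, arithmetic operation (including modulus, phase and nearest integer) or comparison, and operations on the set $L$ count as constantly many steps; a step on registers of $w$ bits counts as $w$ bit operations, where $w=4s+4+\lceil\log_2n\rceil+\lceil\log_2m'\rceil$ (enough for one complex number and two node indices). **Finite-precision signals.** Put $p=\lceil\log_2 n\rceil+P$. For an integer $\kappa\ge0$ call $(x',e)$, with $x'\in\mathbb R^n$ and $e\in\mathbb Z$, a representation of $x\in\mathbb R^n$ if $x'$ is $k$-sparse (at most $k$ nonzero entries), $\|x-x'\|_1\le 2^{-(P+1)}\|x\|_1$, and $2^{e-\kappa p}\le|x'_j|\le 2^e$ whenever $x'_j\neq0$. **Theorem.** For every $d\ge7$ there is an integer $c\ge1$ such that for every $\kappa\ge0$ there are constants $K,T\in\mathbb N$ and $C>0$, depending only on $d,c,\kappa$, such that for all $n\ge2$, $1\le k\le n$, $P\ge0$ and every picking rule, with $s=Kp$, $\tau=2^{-Tp}$ and $m=2ck$ measurements: 1. For every $k$-sparse $x\in\mathbb R^n$, with probability at least $1-C/k$ over $A$, SHO-FA in exact arithmetic applied to $y=Ax$ returns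 $\hat x=x$. 2. For every $k$-sparse $x\in\mathbb R^n$ and every representation $(x',e)$ of $x$, with probability at least $1-C/k$ over $A$, the output $\hat x$ of SHO-FA in fixed-point arithmetic applied to $2^{-e}Ax'$ satisfies $\|x-2^e\hat x\|_1\le2^{-P}\|x\|_1$. If $\kappa\ge3$, every $k$-sparse $x\in\mathbb R^n$ has a representation. 3. For every $A$ of the ensemble and every input, SHO-FA takes at most $Ck$ steps, in exact and in fixed-point arithmetic. 4. For every $A$ of the ensemble and every input, SHO-FA in fixed-point arithmetic uses at most $Ck(\log_2n+P)$ bit operations. -/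

import Mathlib

namespace SHOFA

open Real

/-! ## The random measurement matrix -/

/-- The random choices behind the matrix: a `d`-left-regular bipartite graph with `n` left and `M`
right nodes (for every left node, the set of its `d` neighbours) and a `B`-bit number for every pair
of a right and a left node, which gives the phase of the verification entry of an edge. -/
abbrev Design (n M d B : ℕ) : Type :=
  (Fin n → {s : Finset (Fin M) // s.card = d}) × (Fin M → Fin n → Fin (2 ^ B))

variable {n M d B : ℕ}

/-- The neighbours on the right of the left node `j`. -/
def nbrs (ω : Design n M d B) (j : Fin n) : Finset (Fin M) := (ω.1 j).1

/-- Identification weight of the left node number `j + 1`: the unit complex number of phase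
`(j + 1) π / (2 n)`. -/
noncomputable def coefI (j : Fin n) : ℂ :=
  Complex.exp ((((j : ℕ) + 1 : ℝ) * π / (2 * n) : ℝ) * Complex.I)

/-- Verification weight of the edge between `j` (left) and `i` (right): a unit complex number, of
phase uniform on the `2 ^ B` equally spaced points of `[0, π / 2)`. -/
noncomputable def coefV (ω : Design n M d B) (i : Fin M) (j : Fin n) : ℂ :=
  Complex.exp ((((ω.2 i j : ℕ) : ℝ) / 2 ^ B * (π / 2) : ℝ) * Complex.I)

/-- The measurement matrix, with `2 M` rows: the right node `i` has the identification row `(i, 0)`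
and the verification row `(i, 1)`. -/
noncomputable def sensing (ω : Design n M d B) : Matrix (Fin M × Fin 2) (Fin n) ℂ :=
  fun r j => if r.1 ∈ nbrs ω j then (if r.2 = 0 then coefI j else coefV ω r.1 j) else 0

/-- The measurement vector `A x` of a real vector `x`. -/
noncomputable def measure (ω : Design n M d B) (x : Fin n → ℝ) : Fin M × Fin 2 → ℂ :=
  (sensing ω).mulVec (fun j => (x j : ℂ))

/-- Probability of an event under the uniform distribution on a finite type. -/
noncomputable def prob {Ω : Type} [Fintype Ω] (E : Set Ω) : ℝ :=
  (E.ncard : ℝ) / Fintype.card Ω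

/-! ## Signals -/

/-- `x` has at most `k` nonzero entries. -/
def Sparse (k : ℕ) (x : Fin n → ℝ) : Prop := {j | x j ≠ 0}.ncard ≤ k

/-- The `ℓ₁` norm. -/
noncomputable def l1 (x : Fin n → ℝ) : ℝ := ∑ j, |x j|

/-- `x'` is a `k`-sparse finite-precision representation of `x`: it is accurate to relative `ℓ₁`
error `2 ^ (-(P + 1))`, and with respect to the common binary exponent `e` its nonzero entries span
at most `R` binary orders of magnitude. -/
def Represents (k P R : ℕ) (e : ℤ) (x x' : Fin n → ℝ) : Prop :=
  Sparse k x' ∧ l1 (x - x') ≤ (2 : ℝ) ^ (-((P : ℤ) + 1)) * l1 x ∧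
    ∀ j, x' j ≠ 0 → (2 : ℝ) ^ (e - R) ≤ |x' j| ∧ |x' j| ≤ (2 : ℝ) ^ e

/-! ## Arithmetic and step counting -/

/-- An arithmetic on real registers: every result is passed through `rnd`, and two numbers are taken
to agree if they differ by at most `tol`. -/
structure Arith where
  rnd : ℝ → ℝ
  tol : ℝ

/-- Complex registers hold the real and the imaginary part. -/
def Arith.rndC (ar : Arith) (z : ℂ) : ℂ := ⟨ar.rnd z.re, ar.rnd z.im⟩

/-- Exact real arithmetic. -/
def exact : Arith := ⟨id, 0⟩

/-- Rounding to the fixed-point format with a sign, `s` bits before and `s` bits after the binary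
point, with saturation: the result is an integer multiple of `2 ^ (-s)` in `[-2 ^ s, 2 ^ s]`. -/
noncomputable def fix (s : ℕ) (r : ℝ) : ℝ :=
  max (-(2 ^ s)) (min (2 ^ s) ((round (r * 2 ^ s) : ℝ) / 2 ^ s))

/-- Fixed-point arithmetic with tolerance `2 ^ (-t)`. -/
noncomputable def fixedPoint (s t : ℕ) : Arith := ⟨fix s, (2 : ℝ) ^ (-(t : ℤ))⟩

/-- Length in bits of a register that can hold a complex number of the fixed-point format (two
components, each with a sign, `s` bits after the binary point, and `s + 1` bits before it),
together with the index of a node on the left and one on the right. -/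
def wordBits (s n M : ℕ) : ℕ := 2 * (2 * s + 2) + Nat.clog 2 n + Nat.clog 2 M

/-- A computation: its result and the number of atomic steps that it has taken. -/
structure Timed (α : Type) where
  val : α
  steps : ℕ

instance : Monad Timed where
  pure a := ⟨a, 0⟩
  bind a f := ⟨(f a.val).val, a.steps + (f a.val).steps⟩

/-- One atomic step: an access to a memory cell or a table, an arithmetic operation (including the
modulus and the phase of a complex number, and the nearest integer), or a comparison. -/
def step {α : Type} (a : α) : Timed α := ⟨a, 1⟩

/-- An insertion into, a deletion from or a choice from a set of right nodes; with the set kept as an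
array with back pointers it takes at most six memory accesses. -/
def setOp {α : Type} (a : α) : Timed α := ⟨a, 6⟩

/-! ## The decoder -/

/-- The memory of the decoder: the residual identification and verification vectors, the signal
estimate and the current list of leaf nodes. -/
structure Memory (n M : ℕ) where
  resI : Fin M → ℂ
  resV : Fin M → ℂ
  xhat : Fin n → ℝ
  leaf : Finset (Fin M)

/-- The left node with number `q`, for `1 ≤ q ≤ n`. -/
def toNode (n : ℕ) (q : ℤ) : Option (Fin n) :=
  if h : 1 ≤ q ∧ q ≤ n then some ⟨(q - 1).toNat, by omega⟩ else none

open Classical in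
/-- The test whether the right node `i` is a leaf, that is, whether exactly one left node that is not
yet decoded contributes to its residual. It reads the number `j` of a candidate off the phase of the
identification residual modulo `π` (the sign of the entry being unknown), checks that `j` is a
neighbour of `i`, forms the value `v` of the entry and compares `v` times the verification weight
with the verification residual. If all checks succeed it returns `j` and `v`. -/
noncomputable def leafTest (ar : Arith) (ω : Design n M d B) (μ : Memory n M) (i : Fin M) :
    Timed (Option (Fin n × ℝ)) := do
  let u ← step (μ.resI i)
  let w ← step (μ.resV i)
  let a ← step (ar.rnd ‖u‖)
  let zero ← step (decide (a ≤ ar.tol))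
  if zero then pure none else do
    let φ ← step (ar.rnd u.arg)
    let neg ← step (decide (φ < 0))
    let ψ ← step (if neg then ar.rnd (φ + ar.rnd π) else φ)
    let t ← step (ar.rnd (ψ * ar.rnd (2 * n / π)))
    let q ← step (round t)
    let δ ← step (ar.rnd |t - q|)
    let int ← step (decide (δ ≤ ar.tol))
    if int then do
      let jo ← step (toNode n q)
      match jo with
      | none => pure none
      | some j => do
        let edge ← step (decide (i ∈ nbrs ω j))
        if edge then do
          let aI ← step (ar.rndC (coefI j))
          let aV ← step (ar.rndC (coefV ω i j))
          let v ← step (ar.rndC (u / aI)).re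
          let g ← step (ar.rndC (aV * v))
          let h ← step (ar.rndC (g - w))
          let r ← step (ar.rnd ‖h‖)
          let ok ← step (decide (r ≤ ar.tol))
          if ok then pure (some (j, v)) else pure none
        else pure none
    else pure none

/-- Subtract the contribution of the entry `j` with value `v` from both residuals at `i`. -/
noncomputable def subtract (ar : Arith) (ω : Design n M d B) (j : Fin n) (v : ℝ) (μ : Memory n M)
    (i : Fin M) : Timed (Memory n M) := do
  let aI ← step (ar.rndC (coefI j))
  let aV ← step (ar.rndC (coefV ω i j))
  let u ← step (μ.resI i)
  let w ← step (μ.resV i)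
  let pI ← step (ar.rndC (aI * v))
  let pV ← step (ar.rndC (aV * v))
  let u' ← step (ar.rndC (u - pI))
  let w' ← step (ar.rndC (w - pV))
  let μ ← step { μ with resI := Function.update μ.resI i u' }
  step { μ with resV := Function.update μ.resV i w' }

/-- Update the status of the right node `i` in the list of leaf nodes. -/
noncomputable def refresh (ar : Arith) (ω : Design n M d B) (μ : Memory n M) (i : Fin M) :
    Timed (Memory n M) := do
  let r ← leafTest ar ω μ i
  match r with
  | none => setOp { μ with leaf := μ.leaf.erase i }
  | some _ => setOp { μ with leaf := insert i μ.leaf }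

/-- The neighbours of `j`, in increasing order. -/
def nbrList (ω : Design n M d B) (j : Fin n) : List (Fin M) :=
  (List.finRange M).filter (· ∈ nbrs ω j)

/-- The peeling iterations, at most as many as the first number, the next one being number `t`. In
each of them a node `i` is picked from the list of leaf nodes, its parent `j` is decoded, the
contribution of `j` is subtracted from the residuals at all neighbours of `j`, and the list is
updated. The decoder stops when the list is empty. -/
noncomputable def peel (ar : Arith) (ω : Design n M d B) (pick : ℕ → Finset (Fin M) → Fin M) :
    ℕ → ℕ → Memory n M → Timed (Memory n M)
  | 0, _, μ => pure μ
  | f + 1, t, μ => do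
    let empty ← step (decide (μ.leaf = ∅))
    if empty then pure μ else do
      let i ← setOp (pick t μ.leaf)
      let r ← leafTest ar ω μ i
      let μ ← setOp { μ with leaf := μ.leaf.erase i }
      match r with
      | none => peel ar ω pick f (t + 1) μ
      | some (j, v) => do
        let μ ← step { μ with xhat := Function.update μ.xhat j v }
        let μ ← (nbrList ω j).foldlM (subtract ar ω j v) μ
        let μ ← ((nbrList ω j).erase i).foldlM (refresh ar ω) μ
        peel ar ω pick f (t + 1) μ

/-- Read the measurements of the right node `i` into the residuals. -/
noncomputable def load (ar : Arith) (y : Fin M × Fin 2 → ℂ) (μ : Memory n M) (i : Fin M) :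
    Timed (Memory n M) := do
  let u ← step (ar.rndC (y (i, 0)))
  let w ← step (ar.rndC (y (i, 1)))
  let μ ← step { μ with resI := Function.update μ.resI i u }
  step { μ with resV := Function.update μ.resV i w }

/-- The decoder: from memory that is zero everywhere, read the measurements, make the initial list of
leaf nodes, perform at most `k` peeling iterations, and return the signal estimate. -/
noncomputable def decode (ar : Arith) (ω : Design n M d B) (pick : ℕ → Finset (Fin M) → Fin M)
    (k : ℕ) (y : Fin M × Fin 2 → ℂ) : Timed (Fin n → ℝ) := do
  let μ ← (List.finRange M).foldlM (load ar y) ⟨0, 0, 0, ∅⟩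
  let μ ← (List.finRange M).foldlM (refresh ar ω) μ
  let μ ← peel ar ω pick k 0 μ
  pure μ.xhat

end SHOFA

/-! The two sources of randomness are treated one after the other: the graph decides whether peeling
works and how far errors spread, and the phases only have to make the leaf test reliable.

Graph. A set `S` of left nodes without leaves has at most `d |S| / 2` right neighbours
(`two_mul_card_biUnion_le`). For a fixed support of size at most `k` and `c = 100 d ^ 2`, a first
moment bound (`card_leafless_le`) shows that with probability at least `1 - 1 / k` no nonempty
subset of the support is leafless. Then there is always something to peel, and `k` iterations
exhaust the support.

Errors. An entry decoded at the leaf `i` inherits at most twice the residual error at `i`, plus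
rounding, and that residual error is a sum over the already decoded neighbours of `i`. Unfolding
this recursion bounds the error by the number of self-avoiding walks in the support, each step
having weight two (`walks`). The expected weight from one start is at most `2` (`sum_walks_le`), so
by Markov's inequality the total is at most `2 k ^ 2` outside an event of probability `1 / k`
(`card_manyWalks_le`). Rounding errors are thus amplified only polynomially in `k`, not
exponentially, and a constant multiple of `p` bits suffices.

Phases. An idealised decoder that knows the leaves (`PeelState.run`) uses only the graph and the
identification residuals, so for a given graph its trajectory does not depend on the phases. A false
leaf at a given state and node needs a coincidence of phases of probability at most `2 ^ (-B) ≤ k ^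
(-3)` (`card_collision_mul_le`). A union bound over `k + 1` states and `c k` nodes leaves `O(1 /
k)`. Without a coincidence the actual decoder follows the idealised one (`xhat_peel_eq`).

Exact and fixed-point arithmetic are two instances of `Regime`, so that `le_prob_decode` serves
both. The bounds on steps and bits are deterministic counts. -/

namespace SHOFA

open Real

variable {n M d B : ℕ}

/-! ### Step counts and word length -/

section Timed

variable {α β : Type}

theorem Timed.val_bind (a : Timed α) (f : α → Timed β) : (a >>= f).val = (f a.val).val := rfl

theorem Timed.steps_bind (a : Timed α) (f : α → Timed β) :
    (a >>= f).steps = a.steps + (f a.val).steps := rfl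

theorem Timed.val_pure (a : α) : (pure a : Timed α).val = a := rfl

theorem Timed.steps_pure (a : α) : (pure a : Timed α).steps = 0 := rfl

theorem Timed.val_ite (c : Prop) [Decidable c] (a b : Timed α) :
    (if c then a else b).val = if c then a.val else b.val := apply_ite _ _ _ _

theorem Timed.steps_ite (c : Prop) [Decidable c] (a b : Timed α) :
    (if c then a else b).steps = if c then a.steps else b.steps := apply_ite _ _ _ _

theorem val_step_bind (a : α) (f : α → Timed β) : (step a >>= f).val = (f a).val := rfl

theorem steps_step_bind (a : α) (f : α → Timed β) :
    (step a >>= f).steps = 1 + (f a).steps := rfl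

theorem val_setOp_bind (a : α) (f : α → Timed β) : (setOp a >>= f).val = (f a).val := rfl

theorem steps_setOp_bind (a : α) (f : α → Timed β) :
    (setOp a >>= f).steps = 6 + (f a).steps := rfl

theorem steps_setOp (a : α) : (setOp a).steps = 6 := rfl

theorem Timed.val_foldlM (f : β → α → Timed β) (l : List α) (b : β) :
    (l.foldlM f b).val = l.foldl (fun b a => (f b a).val) b := by
  induction l generalizing b with
  | nil => rfl
  | cons a l ih => simp only [List.foldlM_cons, List.foldl_cons, Timed.val_bind, ih]

theorem Timed.steps_foldlM_le (f : β → α → Timed β) (m : ℕ) (h : ∀ b a, (f b a).steps ≤ m)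
    (l : List α) (b : β) : (l.foldlM f b).steps ≤ l.length * m := by
  induction l generalizing b with
  | nil => simp [Timed.steps_pure]
  | cons a l ih =>
    simp only [List.foldlM_cons, Timed.steps_bind, List.length_cons]
    have := h b a
    have := ih (f b a).val
    linarith [Nat.succ_mul l.length m]

end Timed

theorem steps_leafTest_le (ar : Arith) (ω : Design n M d B) (μ : Memory n M) (i : Fin M) :
    (leafTest ar ω μ i).steps ≤ 21 := by
  unfold leafTest
  simp only [steps_step_bind, Timed.steps_ite, Timed.steps_pure]
  generalize toNode n _ = o
  rcases o with _ | j
  · simp only [Timed.steps_pure]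
    split_ifs <;> omega
  · simp only [steps_step_bind, Timed.steps_ite, Timed.steps_pure]
    split_ifs <;> omega

theorem steps_refresh_le (ar : Arith) (ω : Design n M d B) (μ : Memory n M) (i : Fin M) :
    (refresh ar ω μ i).steps ≤ 27 := by
  unfold refresh
  have := steps_leafTest_le ar ω μ i
  simp only [Timed.steps_bind]
  split <;> simp only [steps_setOp] <;> omega

theorem length_nbrList (ω : Design n M d B) (j : Fin n) : (nbrList ω j).length = d := by
  have h : (nbrList ω j).toFinset = nbrs ω j := by
    ext i; simp [nbrList]
  have h2 : (nbrList ω j).Nodup := (List.nodup_finRange M).filter _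
  rw [← List.toFinset_card_of_nodup h2, h]
  exact (ω.1 j).2

/-- An iteration costs at most `1 + 6 + 21 + 6 + 1 = 35` steps outside the two loops, and `10 + 27`
for each of the `d` neighbours of the decoded node. No property of the residuals is involved. -/
theorem steps_peel_le (ar : Arith) (ω : Design n M d B) (pick : ℕ → Finset (Fin M) → Fin M)
    (f t : ℕ) (μ : Memory n M) : (peel ar ω pick f t μ).steps ≤ f * (35 + 37 * d) := by
  induction f generalizing t μ with
  | zero => simp [peel, Timed.steps_pure]
  | succ f ih =>
    unfold peel
    simp only [steps_step_bind, Timed.steps_ite, Timed.steps_pure]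
    split_ifs
    · nlinarith
    · rw [steps_setOp_bind, Timed.steps_bind, steps_setOp_bind]
      have h1 := steps_leafTest_le ar ω μ (pick t μ.leaf)
      split
      · have := ih (t + 1) { μ with leaf := μ.leaf.erase (pick t μ.leaf) }
        nlinarith
      · rename_i j v _
        dsimp only
        rw [steps_step_bind, Timed.steps_bind, Timed.steps_bind]
        have h2 := Timed.steps_foldlM_le (subtract ar ω j v) 10 (fun _ _ => le_refl 10)
          (nbrList ω j) { resI := μ.resI, resV := μ.resV, xhat := Function.update μ.xhat j v,
                          leaf := μ.leaf.erase (pick t μ.leaf) }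
        have h3 := Timed.steps_foldlM_le (refresh ar ω) 27 (steps_refresh_le ar ω)
          ((nbrList ω j).erase (pick t μ.leaf))
          (List.foldlM (subtract ar ω j v)
            { resI := μ.resI, resV := μ.resV, xhat := Function.update μ.xhat j v,
              leaf := μ.leaf.erase (pick t μ.leaf) } (nbrList ω j)).val
        have h4 := (List.length_erase_le (a := pick t μ.leaf) (l := nbrList ω j))
        rw [length_nbrList] at h2 h4
        have h5 := Nat.mul_le_mul_right 27 h4
        have h6 := ih (t + 1) (List.foldlM (refresh ar ω)
          (List.foldlM (subtract ar ω j v)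
            { resI := μ.resI, resV := μ.resV, xhat := Function.update μ.xhat j v,
              leaf := μ.leaf.erase (pick t μ.leaf) } (nbrList ω j)).val
          ((nbrList ω j).erase (pick t μ.leaf))).val
        nlinarith

theorem steps_decode_le (ar : Arith) (ω : Design n M d B) (pick : ℕ → Finset (Fin M) → Fin M)
    (k : ℕ) (y : Fin M × Fin 2 → ℂ) :
    (decode ar ω pick k y).steps ≤ M * 31 + k * (35 + 37 * d) := by
  unfold decode
  simp only [Timed.steps_bind, Timed.steps_pure]
  have h1 := Timed.steps_foldlM_le (load (n := n) ar y) 4 (fun _ _ => le_refl 4)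
    (List.finRange M) ⟨0, 0, 0, ∅⟩
  have h2 := Timed.steps_foldlM_le (refresh ar ω) 27 (steps_refresh_le ar ω)
    (List.finRange M) (List.foldlM (load ar y) ⟨0, 0, 0, ∅⟩ (List.finRange M)).val
  have h3 := steps_peel_le ar ω pick k 0 (List.foldlM (refresh ar ω)
    (List.foldlM (load ar y) ⟨0, 0, 0, ∅⟩ (List.finRange M)).val (List.finRange M)).val
  rw [List.length_finRange] at h1 h2
  linarith

/-- The word length is linear in `log₂ n + P`. -/
theorem wordBits_le {c k P : ℕ} (hn : 2 ≤ n) (hkn : k ≤ n) (K : ℕ) :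
    (wordBits (K * (Nat.clog 2 n + P)) n (c * k) : ℝ)
      ≤ (8 * K + 8 + c) * (Real.logb 2 n + P) := by
  have hlog : 1 ≤ Real.logb 2 n := by
    rw [Real.le_logb_iff_rpow_le (by norm_num) (by positivity)]
    simpa using (by exact_mod_cast hn : (2 : ℝ) ≤ n)
  have hclog : (Nat.clog 2 n : ℝ) ≤ 2 * Real.logb 2 n := by
    have : (Nat.clog 2 n : ℝ) ≤ Real.logb 2 n + 1 := by
      have h := Real.ceil_logb_natCast (b := 2) (r := (n : ℝ)) (Nat.cast_nonneg n)
      rw [Int.clog_natCast] at h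
      have h2 := (Int.ceil_lt_add_one (Real.logb (2 : ℕ) (n : ℝ))).le
      rw [h] at h2
      exact_mod_cast h2
    linarith
  -- As `c ≤ 2 ^ c` and `k ≤ n`, the factor `c` costs only an additive constant, absorbed later by
  -- `log₂ n ≥ 1`.
  have hck : (Nat.clog 2 (c * k) : ℝ) ≤ c + Nat.clog 2 n := by
    have : Nat.clog 2 (c * k) ≤ c + Nat.clog 2 n := by
      apply Nat.clog_le_of_le_pow
      rw [pow_add]
      exact Nat.mul_le_mul (Nat.lt_two_pow_self).le (hkn.trans (Nat.le_pow_clog one_lt_two n))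
    exact_mod_cast this
  have hP : (0 : ℝ) ≤ P := Nat.cast_nonneg P
  have hK : (0 : ℝ) ≤ K := Nat.cast_nonneg K
  have hc : (0 : ℝ) ≤ c := Nat.cast_nonneg c
  unfold wordBits
  push_cast
  have h1 : (K : ℝ) * (Nat.clog 2 n + P) ≤ K * (2 * (Real.logb 2 n + P)) :=
    mul_le_mul_of_nonneg_left (by linarith) hK
  nlinarith [mul_nonneg hc hP, mul_nonneg hc (sub_nonneg.2 hlog)]

end SHOFA

/-! ### The functions computed by the decoder -/

namespace SHOFA

open Real

variable {n M d B : ℕ}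

open Classical in
/-- The part of the leaf test that reads the candidate off the identification residual `u`. -/
noncomputable def candidate (ar : Arith) (N : Fin n → Finset (Fin M)) (u : ℂ) (i : Fin M) :
    Option (Fin n) :=
  if ar.rnd ‖u‖ ≤ ar.tol then none else
    let φ := ar.rnd u.arg
    let t := ar.rnd ((if φ < 0 then ar.rnd (φ + ar.rnd π) else φ) * ar.rnd (2 * n / π))
    if ar.rnd |t - round t| ≤ ar.tol then
      match toNode n (round t) with
      | none => none
      | some j => if i ∈ N j then some j else none
    else none

/-- The value that the leaf test gives to the candidate `j`. -/
noncomputable def entry (ar : Arith) (u : ℂ) (j : Fin n) : ℝ :=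
  (ar.rndC (u / ar.rndC (coefI j))).re

/-- The computed discrepancy between `v` times the verification weight and the residual `w`. -/
noncomputable def discrepancy (ar : Arith) (a : ℂ) (v : ℝ) (w : ℂ) : ℝ :=
  ar.rnd ‖ar.rndC (ar.rndC (ar.rndC a * v) - w)‖

open Classical in
-- The test splits into a part that sees only the neighbourhoods and the identification residual,
-- and a part that consults the phase of a single edge. This separation allows a peeling run to be
-- defined without reference to the phases.
theorem val_leafTest (ar : Arith) (ω : Design n M d B) (μ : Memory n M) (i : Fin M) :
    (leafTest ar ω μ i).val =
      match candidate ar (nbrs ω) (μ.resI i) i with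
      | none => none
      | some j => if discrepancy ar (coefV ω i j) (entry ar (μ.resI i) j) (μ.resV i) ≤ ar.tol then
          some (j, entry ar (μ.resI i) j) else none := by
  unfold leafTest candidate
  simp only [val_step_bind, Timed.val_ite, Timed.val_pure, decide_eq_true_eq]
  by_cases h1 : ar.rnd ‖μ.resI i‖ ≤ ar.tol
  · simp [h1]
  · simp only [h1, if_false]
    split_ifs with h2 h3
    · generalize toNode n _ = o
      rcases o with _ | j
      · rfl
      · simp only [val_step_bind, Timed.val_ite, Timed.val_pure, decide_eq_true_eq]
        by_cases h3 : i ∈ nbrs ω j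
        · simp only [h3, if_true, entry, discrepancy]
          congr
        · simp [h3]
    · rfl
    · generalize toNode n _ = o
      rcases o with _ | j
      · rfl
      · simp only [val_step_bind, Timed.val_ite, Timed.val_pure, decide_eq_true_eq]
        by_cases h3 : i ∈ nbrs ω j
        · simp only [h3, if_true, entry, discrepancy]
          congr
        · simp [h3]
    · rfl

theorem val_peel_succ (ar : Arith) (ω : Design n M d B) (pick : ℕ → Finset (Fin M) → Fin M)
    (f t : ℕ) (μ : Memory n M) :
    (peel ar ω pick (f + 1) t μ).val = if μ.leaf = ∅ then μ else
      match (leafTest ar ω μ (pick t μ.leaf)).val with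
      | none => (peel ar ω pick f (t + 1) { μ with leaf := μ.leaf.erase (pick t μ.leaf) }).val
      | some (j, v) => (peel ar ω pick f (t + 1)
          (((nbrList ω j).erase (pick t μ.leaf)).foldl (fun μ i => (refresh ar ω μ i).val)
            ((nbrList ω j).foldl (fun μ i => (subtract ar ω j v μ i).val)
              { μ with leaf := μ.leaf.erase (pick t μ.leaf),
                       xhat := Function.update μ.xhat j v }))).val := by
  conv_lhs => unfold peel
  simp only [val_step_bind, Timed.val_ite, Timed.val_pure, decide_eq_true_eq]
  by_cases h : μ.leaf = ∅
  · rw [if_pos h, if_pos h]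
  · rw [if_neg h, if_neg h]
    rw [val_setOp_bind, Timed.val_bind, val_setOp_bind]
    rcases (leafTest ar ω μ (pick t μ.leaf)).val with _ | ⟨j, v⟩
    · rfl
    · dsimp only
      rw [val_step_bind, Timed.val_bind, Timed.val_bind, Timed.val_foldlM, Timed.val_foldlM]

theorem mem_nbrList (ω : Design n M d B) (j : Fin n) (i : Fin M) :
    i ∈ nbrList ω j ↔ i ∈ nbrs ω j := by
  simp [nbrList]

theorem nodup_nbrList (ω : Design n M d B) (j : Fin n) : (nbrList ω j).Nodup :=
  (List.nodup_finRange M).filter _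

/-- A residual after the subtraction of `v` times the coefficient `a`. -/
noncomputable def reduce (ar : Arith) (a : ℂ) (v : ℝ) (u : ℂ) : ℂ :=
  ar.rndC (u - ar.rndC (ar.rndC a * v))

theorem val_subtract (ar : Arith) (ω : Design n M d B) (j : Fin n) (v : ℝ) (μ : Memory n M)
    (i : Fin M) : (subtract ar ω j v μ i).val =
      ⟨Function.update μ.resI i (reduce ar (coefI j) v (μ.resI i)),
        Function.update μ.resV i (reduce ar (coefV ω i j) v (μ.resV i)), μ.xhat, μ.leaf⟩ := rfl

/-- The nodes in the list are distinct, so no residual is changed twice and the successive updates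
amount to one simultaneous update. -/
theorem foldl_subtract (ar : Arith) (ω : Design n M d B) (j : Fin n) (v : ℝ) (l : List (Fin M))
    (hl : l.Nodup) (μ : Memory n M) :
    l.foldl (fun μ i => (subtract ar ω j v μ i).val) μ =
      ⟨fun i => if i ∈ l then reduce ar (coefI j) v (μ.resI i) else μ.resI i,
        fun i => if i ∈ l then reduce ar (coefV ω i j) v (μ.resV i) else μ.resV i,
        μ.xhat, μ.leaf⟩ := by
  induction l generalizing μ with
  | nil => simp
  | cons a l ih =>
    rw [List.nodup_cons] at hl
    rw [List.foldl_cons, ih hl.2, val_subtract]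
    congr 1
    · funext i
      by_cases hi : i = a
      · subst hi; simp [hl.1]
      · simp [hi]
    · funext i
      by_cases hi : i = a
      · subst hi; simp [hl.1]
      · simp [hi]

theorem foldl_load (ar : Arith) (y : Fin M × Fin 2 → ℂ) (l : List (Fin M)) (hl : l.Nodup)
    (μ : Memory n M) :
    l.foldl (fun μ i => (load ar y μ i).val) μ =
      ⟨fun i => if i ∈ l then ar.rndC (y (i, 0)) else μ.resI i,
        fun i => if i ∈ l then ar.rndC (y (i, 1)) else μ.resV i, μ.xhat, μ.leaf⟩ := by
  induction l generalizing μ with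
  | nil => simp
  | cons a l ih =>
    rw [List.nodup_cons] at hl
    rw [List.foldl_cons, ih hl.2]
    have h : (load ar y μ a).val = ⟨Function.update μ.resI a (ar.rndC (y (a, 0))),
        Function.update μ.resV a (ar.rndC (y (a, 1))), μ.xhat, μ.leaf⟩ := rfl
    rw [h]
    congr 1
    · funext i
      by_cases hi : i = a
      · subst hi; simp [hl.1]
      · simp [hi]
    · funext i
      by_cases hi : i = a
      · subst hi; simp [hl.1]
      · simp [hi]

/-- The test reads neither the estimate nor the list of leaves, so refreshing one node does not
influence the tests at the next ones. -/
theorem leafTest_congr (ar : Arith) (ω : Design n M d B) {μ ν : Memory n M}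
    (hI : μ.resI = ν.resI) (hV : μ.resV = ν.resV) (i : Fin M) :
    (leafTest ar ω μ i).val = (leafTest ar ω ν i).val := by
  rw [val_leafTest, val_leafTest, hI, hV]

/-- After a run of updates the status of the nodes in `l` is correct, if `Λ` holds the nodes that
pass the leaf test. -/
theorem foldl_refresh (ar : Arith) (ω : Design n M d B) (Λ : Finset (Fin M)) (l : List (Fin M))
    (μ : Memory n M) (hΛ : ∀ i, i ∈ Λ ↔ ((leafTest ar ω μ i).val).isSome) :
    l.foldl (fun μ i => (refresh ar ω μ i).val) μ =
      { μ with leaf := μ.leaf.filter (· ∉ l) ∪ Λ.filter (· ∈ l) } := by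
  induction l generalizing μ with
  | nil => simp
  | cons a l ih =>
    have h : (refresh ar ω μ a).val =
        { μ with leaf := if a ∈ Λ then insert a μ.leaf else μ.leaf.erase a } := by
      unfold refresh
      rw [Timed.val_bind]
      rcases h : (leafTest ar ω μ a).val with _ | r
      · have : a ∉ Λ := by rw [hΛ, h]; simp
        simp only [this, if_false]; rfl
      · have : a ∈ Λ := by rw [hΛ, h]; simp
        simp only [this, if_true]; rfl
    rw [List.foldl_cons, h, ih]
    · congr 1
      ext i
      by_cases hi : i = a
      · subst hi
        by_cases hiΛ : i ∈ Λ <;> simp [hiΛ, (em (i ∈ l)).symm]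
      · by_cases haΛ : a ∈ Λ <;> simp [haΛ, hi]
    · intro i
      rw [hΛ, leafTest_congr ar ω]
      · rfl
      · rfl

theorem val_decode (ar : Arith) (ω : Design n M d B) (pick : ℕ → Finset (Fin M) → Fin M) (k : ℕ)
    (y : Fin M × Fin 2 → ℂ) (Λ : Finset (Fin M))
    (hΛ : ∀ i, i ∈ Λ ↔ ((leafTest ar ω
      ⟨fun i => ar.rndC (y (i, 0)), fun i => ar.rndC (y (i, 1)), 0, ∅⟩ i).val).isSome) :
    (decode ar ω pick k y).val = (peel ar ω pick k 0
      ⟨fun i => ar.rndC (y (i, 0)), fun i => ar.rndC (y (i, 1)), 0, Λ⟩).val.xhat := by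
  unfold decode
  rw [Timed.val_bind, Timed.val_bind, Timed.val_bind, Timed.val_foldlM, Timed.val_foldlM,
    foldl_load _ _ _ (List.nodup_finRange M)]
  simp only [List.mem_finRange, if_true]
  rw [foldl_refresh ar ω Λ _ _ hΛ]
  simp [Timed.val_pure]

end SHOFA

/-! ### Averaging over random `d`-sets -/

namespace SHOFA

open Real

section Averaging

variable {ι α : Type*} [Fintype ι] [DecidableEq ι] [Fintype α]

/-- Resampling one coordinate does not change the average. -/
theorem sum_sum_update (F : (ι → α) → ℝ) (j : ι) :
    ∑ g : ι → α, ∑ s : α, F (Function.update g j s) = Fintype.card α * ∑ g, F g := by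
  -- Exchanging the coordinate `g j` with the fresh sample is an involution on pairs, whose first
  -- component is the resampled function.
  let e : (ι → α) × α ≃ (ι → α) × α :=
    { toFun := fun p => (Function.update p.1 j p.2, p.1 j)
      invFun := fun p => (Function.update p.1 j p.2, p.1 j)
      left_inv := fun p => by simp
      right_inv := fun p => by simp }
  have h := Equiv.sum_comp e (fun p => F p.1)
  rw [Fintype.sum_prod_type, Fintype.sum_prod_type] at h
  simp only [e, Equiv.coe_fn_mk, Finset.sum_const, Finset.card_univ, nsmul_eq_mul] at h
  rw [h, Finset.mul_sum]

/-- If `H` does not depend on the coordinate `j`, and for all other coordinates a relation to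
coordinate `j` holds with probability at most `q`, then restricting to it costs a factor `q`. -/
theorem sum_ite_le_of_indep (Q : α → (ι → α) → Prop) [∀ s g, Decidable (Q s g)] (H : (ι → α) → ℝ)
    (j : ι) (q : ℝ) (hH0 : ∀ g, 0 ≤ H g) (hH : ∀ g s, H (Function.update g j s) = H g)
    (hQ : ∀ s' g s, Q s' (Function.update g j s) ↔ Q s' g)
    (hq : ∀ g, ((Finset.univ.filter (fun s => Q s g)).card : ℝ) ≤ q * Fintype.card α) :
    ∑ g, (if Q (g j) g then H g else 0) ≤ q * ∑ g, H g := by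
  rcases isEmpty_or_nonempty α with hα | hα
  · have : IsEmpty (ι → α) := ⟨fun g => hα.elim (g j)⟩
    simp
  have hc : (0 : ℝ) < Fintype.card α := by exact_mod_cast Fintype.card_pos
  -- Resample the coordinate `j`: with the others frozen, `H` is constant and the inner sum merely
  -- counts admissible values.
  rw [← mul_le_mul_iff_right₀ hc, ← sum_sum_update]
  calc ∑ g, ∑ s, (if Q (Function.update g j s j) (Function.update g j s)
          then H (Function.update g j s) else 0)
      = ∑ g, ((Finset.univ.filter (fun s => Q s g)).card : ℝ) * H g := by
        refine Finset.sum_congr rfl fun g _ => ?_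
        simp only [Function.update_self, hQ, hH]
        rw [← Finset.sum_filter, Finset.sum_const, nsmul_eq_mul]
    _ ≤ ∑ g, q * Fintype.card α * H g :=
        Finset.sum_le_sum fun g _ => mul_le_mul_of_nonneg_right (hq g) (hH0 g)
    _ = _ := by rw [← Finset.mul_sum]; ring

end Averaging

section Subsets

variable {M d : ℕ}

theorem card_subsets : Fintype.card {s : Finset (Fin M) // s.card = d} = M.choose d := by
  rw [Fintype.card_finset_len, Fintype.card_fin]

theorem card_filter_subtype (p : Finset (Fin M) → Prop) [DecidablePred p] :
    (Finset.univ.filter (fun s : {s : Finset (Fin M) // s.card = d} => p s.1)).card =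
      ((Finset.powersetCard d Finset.univ).filter p).card := by
  refine Finset.card_bij (fun s _ => s.1) ?_ (fun _ _ _ _ h => Subtype.ext h) ?_
  · intro s hs
    simp only [Finset.mem_filter, Finset.mem_univ, true_and] at hs
    simp [s.2, hs]
  · intro s hs
    simp only [Finset.mem_filter, Finset.mem_powersetCard, Finset.subset_univ, true_and] at hs
    exact ⟨⟨s, hs.1⟩, by simp [hs.2], rfl⟩

/-- The sets avoiding `i` are the `d`-subsets of the other `M - 1` nodes. Pascal's rule then counts
the sets through `i`, and the absorption identity for binomial coefficients gives the ratio `d / M`.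
-/
theorem card_mem (hd : 1 ≤ d) (i : Fin M) :
    M * (Finset.univ.filter (fun s : {s : Finset (Fin M) // s.card = d} => i ∈ s.1)).card
      = M.choose d * d := by
  obtain ⟨d, rfl⟩ : ∃ e, d = e + 1 := ⟨d - 1, by omega⟩
  obtain ⟨M, rfl⟩ : ∃ e, M = e + 1 := ⟨M - 1, by have := i.pos; omega⟩
  rw [card_filter_subtype (fun s => i ∈ s)]
  have h : ((Finset.powersetCard (d + 1) Finset.univ).filter (fun s : Finset (Fin (M + 1)) => i ∉ s))
      = Finset.powersetCard (d + 1) (Finset.univ.erase i) := by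
    ext s
    simp only [Finset.mem_filter, Finset.mem_powersetCard, Finset.subset_univ, true_and,
      Finset.subset_erase]
    tauto
  have h2 := Finset.card_filter_add_card_filter_not (s := Finset.powersetCard (d + 1) Finset.univ)
    (fun s : Finset (Fin (M + 1)) => i ∈ s)
  rw [h, Finset.card_powersetCard, Finset.card_powersetCard, Finset.card_erase_of_mem (by simp),
    Finset.card_univ, Fintype.card_fin, Nat.choose_succ_succ] at h2
  simp only [Nat.add_sub_cancel] at h2
  have h3 : ((Finset.powersetCard (d + 1) Finset.univ).filter
      (fun s : Finset (Fin (M + 1)) => i ∈ s)).card = M.choose d := by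
    simp only [Nat.succ_eq_add_one] at h2
    omega
  rw [h3, Nat.add_one_mul_choose_eq]

/-- A random `d`-set meets a given `d`-set with probability at most `d ^ 2 / M`. -/
theorem card_meets_le (hd : 1 ≤ d) (R : Finset (Fin M)) (hR : R.card = d) :
    ((Finset.univ.filter (fun s : {s : Finset (Fin M) // s.card = d} => ¬ Disjoint s.1 R)).card : ℝ)
      ≤ ((d : ℝ) ^ 2 / M) * Fintype.card {s : Finset (Fin M) // s.card = d} := by
  obtain ⟨i0, -⟩ : R.Nonempty := by rw [← Finset.card_pos]; omega
  have hM : (0 : ℝ) < M := by exact_mod_cast i0.pos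
  have hsub : (Finset.univ.filter
      (fun s : {s : Finset (Fin M) // s.card = d} => ¬ Disjoint s.1 R)) ⊆
      R.biUnion (fun i => Finset.univ.filter
        (fun s : {s : Finset (Fin M) // s.card = d} => i ∈ s.1)) := by
    intro s hs
    simp only [Finset.mem_filter, Finset.mem_univ, true_and, Finset.not_disjoint_iff] at hs
    obtain ⟨i, h1, h2⟩ := hs
    simp only [Finset.mem_biUnion, Finset.mem_filter, Finset.mem_univ, true_and]
    exact ⟨i, h2, h1⟩
  have h1 := (Finset.card_le_card hsub).trans Finset.card_biUnion_le
  have h2 : ∀ i : Fin M, ((Finset.univ.filter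
      (fun s : {s : Finset (Fin M) // s.card = d} => i ∈ s.1)).card : ℝ)
      = d / M * M.choose d := by
    intro i
    have : (M : ℝ) * ((Finset.univ.filter
      (fun s : {s : Finset (Fin M) // s.card = d} => i ∈ s.1)).card : ℝ) = M.choose d * d := by
      exact_mod_cast card_mem hd i
    field_simp
    linarith
  calc _ ≤ ((∑ i ∈ R, (Finset.univ.filter
      (fun s : {s : Finset (Fin M) // s.card = d} => i ∈ s.1)).card : ℕ) : ℝ) := by exact_mod_cast h1
    _ = _ := by
      push_cast
      rw [Finset.sum_congr rfl (fun i _ => h2 i), Finset.sum_const, hR, card_subsets, nsmul_eq_mul]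
      ring

/-- Sampling without replacement stays inside a subset no more often than sampling with replacement:
every factor `(m - i) / (M - i)` is at most `m / M`. -/
theorem choose_mul_pow_le {m M : ℕ} (h : m ≤ M) (d : ℕ) :
    m.choose d * M ^ d ≤ M.choose d * m ^ d := by
  have key : m.descFactorial d * M ^ d ≤ M.descFactorial d * m ^ d := by
    induction d with
    | zero => simp
    | succ d ih =>
      rw [Nat.descFactorial_succ, Nat.descFactorial_succ, pow_succ, pow_succ]
      have : (m - d) * M ≤ (M - d) * m := by
        rw [Nat.sub_mul, Nat.sub_mul, Nat.mul_comm M m]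
        exact Nat.sub_le_sub_left (Nat.mul_le_mul_left d h) _
      calc (m - d) * m.descFactorial d * (M ^ d * M)
          = ((m - d) * M) * (m.descFactorial d * M ^ d) := by ring
        _ ≤ ((M - d) * m) * (M.descFactorial d * m ^ d) := Nat.mul_le_mul this ih
        _ = _ := by ring
  rw [Nat.descFactorial_eq_factorial_mul_choose, Nat.descFactorial_eq_factorial_mul_choose,
    mul_assoc, mul_assoc] at key
  exact Nat.le_of_mul_le_mul_left key (Nat.factorial_pos d)

/-- The probability that `d`-sets, one for every member of `S`, all lie in `R`. -/
theorem card_forall_subset_le {n : ℕ} (hM : 0 < M) (S : Finset (Fin n)) (R : Finset (Fin M)) :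
    ((Finset.univ.filter (fun g : Fin n → {s : Finset (Fin M) // s.card = d} =>
        ∀ j ∈ S, (g j).1 ⊆ R)).card : ℝ)
      ≤ ((R.card : ℝ) / M) ^ (d * S.card) *
        Fintype.card (Fin n → {s : Finset (Fin M) // s.card = d}) := by
  have hM' : (0 : ℝ) < M := by exact_mod_cast hM
  have h1 : (Finset.univ.filter (fun g : Fin n → {s : Finset (Fin M) // s.card = d} =>
      ∀ j ∈ S, (g j).1 ⊆ R)) = Fintype.piFinset (fun j => if j ∈ S then
        Finset.univ.filter (fun s : {s : Finset (Fin M) // s.card = d} => s.1 ⊆ R)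
        else Finset.univ) := by
    ext g
    simp only [Finset.mem_filter, Finset.mem_univ, true_and, Fintype.mem_piFinset]
    refine forall_congr' fun j => ?_
    split_ifs with h <;> simp [h]
  have h2 : (Finset.univ.filter (fun s : {s : Finset (Fin M) // s.card = d} => s.1 ⊆ R)).card
      = R.card.choose d := by
    rw [card_filter_subtype (fun s => s ⊆ R), ← Finset.card_powersetCard]
    congr 1
    ext s
    simp only [Finset.mem_filter, Finset.mem_powersetCard, Finset.subset_univ, true_and]
    tauto
  have h3 : ((R.card.choose d : ℕ) : ℝ) ≤ ((R.card : ℝ) / M) ^ d * M.choose d := by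
    have := choose_mul_pow_le (m := R.card) (M := M) (by simpa using R.card_le_univ) d
    have h' : ((R.card.choose d : ℕ) : ℝ) * (M : ℝ) ^ d ≤ M.choose d * (R.card : ℝ) ^ d := by
      exact_mod_cast this
    rw [div_pow, div_mul_eq_mul_div, le_div_iff₀ (by positivity)]
    linarith
  rw [h1, Fintype.card_piFinset, Nat.cast_prod]
  calc _ ≤ ∏ j : Fin n, ((if j ∈ S then ((R.card : ℝ) / M) ^ d else 1) * (M.choose d : ℝ)) := by
        refine Finset.prod_le_prod (fun _ _ => Nat.cast_nonneg _) fun j _ => ?_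
        split_ifs with h
        · rw [h2]; exact h3
        · rw [Finset.card_univ, card_subsets, one_mul]
    _ = _ := by
      rw [Finset.prod_mul_distrib, Finset.prod_ite_mem, Finset.univ_inter, Finset.prod_const,
        Finset.prod_const, Fintype.card_fun, card_subsets, Finset.card_univ, Nat.cast_pow, pow_mul]

end Subsets

/-! ### Self-avoiding walks that carry the errors -/

section Walks

variable {n M d : ℕ}

/-- Weighted number of self-avoiding walks with at most `r` steps that start in `j`, continue in
`T`, and step between left nodes with a common neighbour; every step has the weight two. -/
noncomputable def walks (N : Fin n → Finset (Fin M)) : ℕ → Finset (Fin n) → Fin n → ℝ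
  | 0, _, _ => 1
  | r + 1, T, j => 1 + 2 * ∑ j' ∈ T, if ¬ Disjoint (N j) (N j') then walks N r (T.erase j') j' else 0

theorem one_le_walks (N : Fin n → Finset (Fin M)) (r : ℕ) (T : Finset (Fin n)) (j : Fin n) :
    1 ≤ walks N r T j := by
  induction r generalizing T j with
  | zero => simp [walks]
  | succ r ih =>
    have : 0 ≤ ∑ j' ∈ T, if ¬ Disjoint (N j) (N j') then walks N r (T.erase j') j' else 0 :=
      Finset.sum_nonneg fun j' _ => by
        split_ifs
        · exact le_rfl
        · linarith [ih (T.erase j') j']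
    simp only [walks]
    linarith

theorem walks_mono (N : Fin n → Finset (Fin M)) {r r' : ℕ} (hr : r ≤ r') {T T' : Finset (Fin n)}
    (hT : T ⊆ T') (j : Fin n) : walks N r T j ≤ walks N r' T' j := by
  induction r generalizing r' T T' j with
  | zero => simpa [walks] using one_le_walks N r' T' j
  | succ r ih =>
    obtain ⟨r', rfl⟩ : ∃ e, r' = e + 1 := ⟨r' - 1, by omega⟩
    simp only [walks]
    have h1 : ∑ j' ∈ T, (if ¬ Disjoint (N j) (N j') then walks N r (T.erase j') j' else 0) ≤
        ∑ j' ∈ T, (if ¬ Disjoint (N j) (N j') then walks N r' (T'.erase j') j' else 0) := by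
      refine Finset.sum_le_sum fun j' _ => ?_
      split_ifs
      · exact le_rfl
      · exact ih (by omega) (Finset.erase_subset_erase _ hT) j'
    have h2 : ∑ j' ∈ T, (if ¬ Disjoint (N j) (N j') then walks N r' (T'.erase j') j' else 0) ≤
        ∑ j' ∈ T', (if ¬ Disjoint (N j) (N j') then walks N r' (T'.erase j') j' else 0) := by
      refine Finset.sum_le_sum_of_subset_of_nonneg hT fun j' _ _ => ?_
      split_ifs
      · exact le_rfl
      · linarith [one_le_walks N r' (T'.erase j') j']
    linarith

/-- Walks see only the neighbourhoods of `j` and of `T`. This is the independence that lets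
`sum_walks_le` resample the neighbourhood of a starting node. -/
theorem walks_congr {N N' : Fin n → Finset (Fin M)} (r : ℕ) (T : Finset (Fin n)) (j : Fin n)
    (hj : N j = N' j) (hT : ∀ a ∈ T, N a = N' a) : walks N r T j = walks N' r T j := by
  induction r generalizing T j with
  | zero => simp [walks]
  | succ r ih =>
    simp only [walks]
    congr 2
    refine Finset.sum_congr rfl fun j' hj' => ?_
    rw [hj, hT j' hj', ih (T.erase j') j' (hT j' hj') fun a ha => hT a (Finset.mem_of_mem_erase ha)]

/-- The expected number of walks is at most two. -/
theorem sum_walks_le {k : ℕ} (hd : 1 ≤ d) (hM : 4 * d ^ 2 * k ≤ M) (r : ℕ)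
    (T : Finset (Fin n)) (j : Fin n) (hj : j ∉ T) (hT : T.card ≤ k) :
    ∑ g : Fin n → {s : Finset (Fin M) // s.card = d}, walks (fun a => (g a).1) r T j
      ≤ 2 * Fintype.card (Fin n → {s : Finset (Fin M) // s.card = d}) := by
  induction r generalizing T j with
  | zero =>
    simp only [walks, Finset.sum_const, Finset.card_univ, nsmul_eq_mul, mul_one]
    have : (0 : ℝ) ≤ Fintype.card (Fin n → {s : Finset (Fin M) // s.card = d}) := Nat.cast_nonneg _
    linarith
  | succ r ih =>
    set G : ℝ := (Fintype.card (Fin n → {s : Finset (Fin M) // s.card = d}) : ℝ) with hG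
    have hG0 : 0 ≤ G := Nat.cast_nonneg _
    -- The walk never returns to `j`, so its continuation from `j'` is independent of the
    -- neighbourhood of `j`. The first step costs a factor `d ^ 2 / M`, and the induction hypothesis
    -- bounds the rest.
    have h1 : ∀ j' ∈ T, ∑ g : Fin n → {s : Finset (Fin M) // s.card = d},
        (if ¬ Disjoint (g j).1 (g j').1 then walks (fun a => (g a).1) r (T.erase j') j' else 0)
        ≤ ((d : ℝ) ^ 2 / M) * (2 * G) := by
      intro j' hj'
      have hne : j' ≠ j := fun h => hj (h ▸ hj')
      refine (sum_ite_le_of_indep (fun (s : {s : Finset (Fin M) // s.card = d}) g =>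
        ¬ Disjoint s.1 (g j').1) (fun g => walks (fun a => (g a).1) r (T.erase j') j') j
        ((d : ℝ) ^ 2 / M) ?_ ?_ ?_ ?_).trans ?_
      · intro g; linarith [one_le_walks (fun a => (g a).1) r (T.erase j') j']
      · intro g s
        apply walks_congr
        · simp [hne]
        · intro a ha
          have : a ≠ j := fun h => hj (h ▸ Finset.mem_of_mem_erase ha)
          simp [this]
      · intro s' g s
        simp [hne]
      · intro g
        exact card_meets_le hd _ (g j').2
      · refine mul_le_mul_of_nonneg_left ?_ (by positivity)
        exact ih (T.erase j') j' (Finset.notMem_erase _ _)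
          ((Finset.card_le_card (Finset.erase_subset _ _)).trans hT)
    simp only [walks]
    rw [Finset.sum_add_distrib, ← Finset.mul_sum, Finset.sum_comm, Finset.sum_const,
      Finset.card_univ, nsmul_eq_mul, mul_one, ← hG]
    have h2 := Finset.sum_le_sum h1
    rw [Finset.sum_const, nsmul_eq_mul] at h2
    -- Here `M ≥ 4 d ^ 2 k` enters: the expected number of possible first steps is at most `1 / 4`.
    -- With weight two per step and the bound two for each continuation, this adds at most `1` to
    -- the empty walk, so the bound two reproduces itself.
    have h3 : (T.card : ℝ) * ((d : ℝ) ^ 2 / M * (2 * G)) ≤ G / 2 := by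
      rcases Nat.eq_zero_or_pos M with rfl | hM0
      · simp; positivity
      · have hM0' : (0 : ℝ) < M := by exact_mod_cast hM0
        have h4 : (T.card : ℝ) * d ^ 2 * 4 ≤ M := by
          have : T.card * d ^ 2 * 4 ≤ M := le_trans (by nlinarith [sq_nonneg d]) hM
          exact_mod_cast this
        have : (T.card : ℝ) * ((d : ℝ) ^ 2 / M * (2 * G)) = (T.card * d ^ 2 * 4) * G / (2 * M) := by
          field_simp; ring
        rw [this, div_le_div_iff₀ (by positivity) (by norm_num)]
        nlinarith
    linarith

end Walks

end SHOFA

/-! ### Leafless sets and large walk counts are rare -/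

namespace SHOFA

open Real

variable {n M d : ℕ}

/-- The right nodes with exactly one neighbour in `S`. -/
def leaves (N : Fin n → Finset (Fin M)) (S : Finset (Fin n)) : Finset (Fin M) :=
  Finset.univ.filter fun i => (S.filter (i ∈ N ·)).card = 1

/-- Without leaves, the neighbourhood has at most half as many nodes as there are edges. -/
theorem two_mul_card_biUnion_le {N : Fin n → Finset (Fin M)} (hN : ∀ j, (N j).card = d)
    {S : Finset (Fin n)} (hS : leaves N S = ∅) : 2 * (S.biUnion N).card ≤ d * S.card := by
  -- The edges at `S`, counted from the right. In the absence of leaves every right node involved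
  -- accounts for at least two of them.
  have h1 : ∑ i ∈ S.biUnion N, (S.filter (i ∈ N ·)).card = d * S.card := by
    have : ∀ j ∈ S, ((S.biUnion N).filter (· ∈ N j)).card = d := by
      intro j hj
      rw [← hN j]
      congr 1
      ext i
      simp only [Finset.mem_filter, Finset.mem_biUnion]
      exact ⟨fun h => h.2, fun h => ⟨⟨j, hj, h⟩, h⟩⟩
    have h := Finset.sum_card_bipartiteAbove_eq_sum_card_bipartiteBelow
      (s := S.biUnion N) (t := S) (fun i j => i ∈ N j)
    simp only [Finset.bipartiteAbove, Finset.bipartiteBelow] at h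
    rw [h, Finset.sum_congr rfl this, Finset.sum_const, smul_eq_mul, mul_comm]
  rw [← h1, mul_comm, ← smul_eq_mul, ← Finset.sum_const]
  refine Finset.sum_le_sum fun i hi => ?_
  obtain ⟨j, hj, hij⟩ := Finset.mem_biUnion.1 hi
  have h2 : 0 < (S.filter (i ∈ N ·)).card :=
    Finset.card_pos.2 ⟨j, Finset.mem_filter.2 ⟨hj, hij⟩⟩
  have h3 : (S.filter (i ∈ N ·)).card ≠ 1 := by
    intro h
    have : i ∈ leaves N S := by simp [leaves, h]
    rw [hS] at this
    simp at this
  omega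

/-- Combine `N.choose r ≤ N ^ r / r!` with `r ^ r / r! ≤ e ^ r ≤ 3 ^ r`, where `r ^ r / r!` is a
single term of the exponential series. -/
theorem choose_le_three_mul_div_pow {N r : ℕ} (hr : 1 ≤ r) :
    (N.choose r : ℝ) ≤ (3 * N / r) ^ r := by
  have hr' : (0 : ℝ) < r := by exact_mod_cast hr
  have h1 : (r : ℝ) ^ r / r.factorial ≤ 3 ^ r := by
    refine (Real.pow_div_factorial_le_exp r (Nat.cast_nonneg _) r).trans ?_
    rw [← mul_one (r : ℝ), Real.exp_nat_mul]
    exact pow_le_pow_left₀ (Real.exp_pos _).le Real.exp_one_lt_three.le r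
  refine (Nat.choose_le_pow_div r N).trans ?_
  rw [div_pow, mul_pow, div_le_div_iff₀ (by positivity) (by positivity)]
  rw [div_le_iff₀ (by positivity)] at h1
  calc (N : ℝ) ^ r * (r : ℝ) ^ r ≤ (N : ℝ) ^ r * (3 ^ r * r.factorial) :=
        mul_le_mul_of_nonneg_left h1 (by positivity)
    _ = _ := by ring

/-- The first moment bound for leafless sets of size `s`. -/
theorem choose_mul_choose_mul_pow_le {c k s : ℕ} (hd : 7 ≤ d) (hc : 100 * d ^ 2 ≤ c) (hs : 1 ≤ s)
    (hsk : s ≤ k) :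
    (k.choose s : ℝ) * (((c * k).choose (d * s / 2) : ℝ) *
      (((d * s / 2 : ℕ) : ℝ) / (c * k : ℕ)) ^ (d * s)) ≤ (1 / 2) ^ s / k ^ 2 := by
  set m := d * s / 2 with hm
  have hds : 7 * s ≤ d * s := Nat.mul_le_mul_right s hd
  have hm3 : 3 * s ≤ m := by omega
  have hm2 : 2 * m ≤ d * s := by omega
  have hk0 : 1 ≤ k := hs.trans hsk
  have hs' : (0 : ℝ) < s := by exact_mod_cast hs
  have hk' : (0 : ℝ) < k := by exact_mod_cast hk0
  have hc0 : 0 < c := by nlinarith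
  have hc' : (0 : ℝ) < c := by exact_mod_cast hc0
  have hm' : (0 : ℝ) < m := by
    have : 0 < m := by omega
    exact_mod_cast this
  set M := c * k with hM
  have hM' : (0 : ℝ) < M := by rw [hM]; push_cast; positivity
  set y : ℝ := s / k with hy
  have hy0 : 0 < y := by positivity
  have hy1 : y ≤ 1 := by
    rw [hy, div_le_one hk']; exact_mod_cast hsk
  set x : ℝ := m / M with hx
  have hx0 : 0 < x := by positivity
  -- The size of `c` is used here: `36 m ≤ 18 d s ≤ c s`, that is, `x ≤ y / 36`.
  have hxy : 3 * x ≤ y / 12 := by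
    have h1 : 36 * (m * k) ≤ s * M := by
      have : 36 * m ≤ s * c := by nlinarith
      calc 36 * (m * k) = 36 * m * k := by ring
        _ ≤ s * c * k := Nat.mul_le_mul_right k this
        _ = s * M := by rw [hM]; ring
    have h2 : 36 * ((m : ℝ) * k) ≤ s * M := by exact_mod_cast h1
    rw [hx, hy, div_div, ← mul_div_assoc, div_le_div_iff₀ hM' (by positivity)]
    nlinarith
  have hx1 : x ≤ 1 := by linarith
  -- The binomial coefficient is at most `(3 / x) ^ m`, whereas `x ^ (d s) ≤ x ^ (2 m)`. The product
  -- `(3 x) ^ m` is small, and `m ≥ 3 s` provides three powers of `y` per element of the set.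
  have h1 : (M.choose m : ℝ) * x ^ (d * s) ≤ (y / 12) ^ (3 * s) := by
    calc (M.choose m : ℝ) * x ^ (d * s) ≤ (3 * M / m) ^ m * x ^ (2 * m) := by
          refine mul_le_mul (choose_le_three_mul_div_pow (by omega)) ?_ (by positivity)
            (by positivity)
          exact pow_le_pow_of_le_one hx0.le hx1 hm2
      _ = (3 * x) ^ m := by
          rw [pow_mul, ← mul_pow]
          congr 1
          rw [hx]; field_simp
      _ ≤ (3 * x) ^ (3 * s) := pow_le_pow_of_le_one (by positivity) (by linarith) hm3
      _ ≤ _ := pow_le_pow_left₀ (by positivity) hxy _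
  have h2 : (k.choose s : ℝ) ≤ (3 / y) ^ s := by
    refine (choose_le_three_mul_div_pow hs).trans (le_of_eq ?_)
    congr 1
    rw [hy]; field_simp
  have h3 : (s : ℝ) ^ 2 ≤ 4 ^ s := by
    have : s ^ 2 ≤ 4 ^ s := by
      calc s ^ 2 ≤ (2 ^ s) ^ 2 := Nat.pow_le_pow_left Nat.lt_two_pow_self.le 2
        _ = 4 ^ s := by rw [← pow_mul, mul_comm, pow_mul]; norm_num
    exact_mod_cast this
  -- One power `y ^ s` cancels against the choice of the set. Of the remaining `y ^ (2 s)` only `y ^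
  -- 2 = s ^ 2 / k ^ 2` is kept, and `s ^ 2 ≤ 4 ^ s` is absorbed by the geometric factor.
  calc _ ≤ (3 / y) ^ s * (y / 12) ^ (3 * s) := mul_le_mul h2 h1 (by positivity) (by positivity)
    _ = (y ^ 2) ^ s * (1 / 576) ^ s := by
        rw [pow_mul, ← mul_pow, ← mul_pow]
        congr 1
        field_simp
        norm_num
    _ ≤ (y ^ 2) ^ 1 * (1 / 8) ^ s := by
        refine mul_le_mul ?_ ?_ (by positivity) (by positivity)
        · exact pow_le_pow_of_le_one (by positivity) (by nlinarith) hs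
        · exact pow_le_pow_left₀ (by norm_num) (by norm_num) _
    _ = (s : ℝ) ^ 2 * (1 / 8) ^ s / k ^ 2 := by rw [hy, pow_one, div_pow]; ring
    _ ≤ _ := by
        refine div_le_div_of_nonneg_right ?_ (by positivity)
        calc (s : ℝ) ^ 2 * (1 / 8) ^ s ≤ 4 ^ s * (1 / 8) ^ s :=
              mul_le_mul_of_nonneg_right h3 (by positivity)
          _ = _ := by rw [← mul_pow]; norm_num

/-- Some nonempty subset of `S₀` has no leaf. -/
def Leafless (N : Fin n → Finset (Fin M)) (S₀ : Finset (Fin n)) : Prop :=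
  ∃ S ⊆ S₀, S.Nonempty ∧ leaves N S = ∅

open Classical in
-- Union bound over the leafless set `S` and over a set `R` of exactly `d |S| / 2` right nodes
-- (rounded down) that contains its neighbourhood. The sizes `s` contribute at most `2 ^ (-s) / k ^
-- 2` each.
theorem card_leafless_le {c k : ℕ} (hd : 7 ≤ d) (hc : 100 * d ^ 2 ≤ c) (hk : 1 ≤ k)
    (S₀ : Finset (Fin n)) (hS₀ : S₀.card ≤ k) :
    ((Finset.univ.filter (fun g : Fin n → {s : Finset (Fin (c * k)) // s.card = d} =>
      Leafless (fun j => (g j).1) S₀)).card : ℝ)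
      ≤ 1 / k * Fintype.card (Fin n → {s : Finset (Fin (c * k)) // s.card = d}) := by
  have hk' : (0 : ℝ) < k := by exact_mod_cast hk
  have hc0 : 0 < c := by nlinarith
  have hM : 0 < c * k := by positivity
  set G : ℝ := (Fintype.card (Fin n → {s : Finset (Fin (c * k)) // s.card = d}) : ℝ) with hG
  have hG0 : 0 ≤ G := Nat.cast_nonneg _
  let A : Finset (Fin n) → Finset (Fin n → {s : Finset (Fin (c * k)) // s.card = d}) := fun S =>
    (Finset.powersetCard (d * S.card / 2) Finset.univ).biUnion fun R =>
      Finset.univ.filter fun g => ∀ j ∈ S, (g j).1 ⊆ R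
  have hsub : (Finset.univ.filter (fun g : Fin n → {s : Finset (Fin (c * k)) // s.card = d} =>
      Leafless (fun j => (g j).1) S₀)) ⊆
      (S₀.powerset.filter Finset.Nonempty).biUnion A := by
    intro g hg
    obtain ⟨S, hS, hne, hl⟩ := (Finset.mem_filter.1 hg).2
    have h1 := two_mul_card_biUnion_le (fun j => (g j).2) hl
    have hSk : S.card ≤ k := (Finset.card_le_card hS).trans hS₀
    have h2 : d * S.card / 2 ≤ (Finset.univ : Finset (Fin (c * k))).card := by
      rw [Finset.card_univ, Fintype.card_fin]
      have : d * S.card ≤ c * k := Nat.mul_le_mul (by nlinarith) hSk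
      omega
    obtain ⟨R, hR1, -, hR2⟩ := Finset.exists_subsuperset_card_eq
      (Finset.subset_univ (S.biUnion fun j => (g j).1)) (n := d * S.card / 2) (by omega) h2
    simp only [A, Finset.mem_biUnion, Finset.mem_filter, Finset.mem_powerset,
      Finset.mem_powersetCard, Finset.mem_univ, true_and, Finset.subset_univ]
    exact ⟨S, ⟨hS, hne⟩, R, hR2, fun j hj => (Finset.subset_biUnion_of_mem
      (fun j => (g j).1) hj).trans hR1⟩
  let b : ℕ → ℝ := fun s => (((c * k).choose (d * s / 2) : ℝ) *
      (((d * s / 2 : ℕ) : ℝ) / (c * k : ℕ)) ^ (d * s))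
  have hb0 : ∀ s, 0 ≤ b s := fun s => by positivity
  have hA : ∀ S, ((A S).card : ℝ) ≤ b S.card * G := by
    intro S
    calc ((A S).card : ℝ) ≤ ∑ R ∈ Finset.powersetCard (d * S.card / 2) Finset.univ,
          ((Finset.univ.filter fun g : Fin n → {s : Finset (Fin (c * k)) // s.card = d} =>
            ∀ j ∈ S, (g j).1 ⊆ R).card : ℝ) := by
          exact_mod_cast Finset.card_biUnion_le
      _ ≤ ∑ R ∈ Finset.powersetCard (d * S.card / 2) (Finset.univ : Finset (Fin (c * k))),
          (((d * S.card / 2 : ℕ) : ℝ) / (c * k : ℕ)) ^ (d * S.card) * G := by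
          refine Finset.sum_le_sum fun R hR => ?_
          rw [← (Finset.mem_powersetCard.1 hR).2]
          have := card_forall_subset_le (d := d) hM S R
          rw [(Finset.mem_powersetCard.1 hR).2] at this ⊢
          exact this
      _ = _ := by
          rw [Finset.sum_const, Finset.card_powersetCard, Finset.card_univ, Fintype.card_fin,
            nsmul_eq_mul]
          ring
  calc _ ≤ (((S₀.powerset.filter Finset.Nonempty).biUnion A).card : ℝ) := by
        exact_mod_cast Finset.card_le_card hsub
    _ ≤ ∑ S ∈ S₀.powerset.filter Finset.Nonempty, ((A S).card : ℝ) := by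
        exact_mod_cast Finset.card_biUnion_le
    _ ≤ ∑ S ∈ S₀.powerset.filter Finset.Nonempty, b S.card * G :=
        Finset.sum_le_sum fun S _ => hA S
    _ = ∑ S ∈ S₀.powerset, (fun s => if s = 0 then 0 else b s * G) S.card := by
        rw [Finset.sum_filter]
        refine Finset.sum_congr rfl fun S _ => ?_
        by_cases h : S.Nonempty
        · simp [h, h.ne_empty]
        · simp [Finset.not_nonempty_iff_eq_empty.1 h]
    _ = ∑ s ∈ Finset.range (S₀.card + 1), S₀.card.choose s •
          (if s = 0 then 0 else b s * G) := by
        rw [Finset.sum_powerset_apply_card (fun s => if s = 0 then 0 else b s * G)]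
    _ = ∑ s ∈ Finset.range S₀.card, S₀.card.choose (s + 1) • (b (s + 1) * G) := by
        rw [Finset.sum_range_succ']
        simp
    _ ≤ ∑ s ∈ Finset.range S₀.card, ((1 / 2 : ℝ) ^ (s + 1) / k ^ 2) * G := by
        refine Finset.sum_le_sum fun s hs => ?_
        have hs' : s + 1 ≤ k := (Finset.mem_range.1 hs).trans_le hS₀
        have h1 : ((S₀.card.choose (s + 1) : ℕ) : ℝ) ≤ k.choose (s + 1) := by
          exact_mod_cast Nat.choose_le_choose _ hS₀
        rw [nsmul_eq_mul, ← mul_assoc]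
        refine mul_le_mul_of_nonneg_right ?_ hG0
        exact (mul_le_mul_of_nonneg_right h1 (hb0 _)).trans
          (choose_mul_choose_mul_pow_le hd hc (by omega) hs')
    _ = (∑ s ∈ Finset.range S₀.card, (1 / 2 : ℝ) ^ s) * (1 / 2) / k ^ 2 * G := by
        rw [Finset.sum_mul, Finset.sum_div, Finset.sum_mul]
        simp only [pow_succ]
    _ ≤ 2 * (1 / 2) / k ^ 2 * G := by
        gcongr
        exact sum_geometric_two_le _
    _ ≤ 1 / k * G := by
        refine mul_le_mul_of_nonneg_right ?_ hG0
        rw [div_le_div_iff₀ (by positivity) hk']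
        have : (1 : ℝ) ≤ k := by exact_mod_cast hk
        nlinarith

/-- The total number of walks in `S₀` is large. -/
def ManyWalks (N : Fin n → Finset (Fin M)) (k : ℕ) (S₀ : Finset (Fin n)) : Prop :=
  2 * (k : ℝ) ^ 2 < ∑ j ∈ S₀, walks N k (S₀.erase j) j

open Classical in
-- Markov's inequality: the expected total over the at most `k` starting nodes is at most `2 k`, and
-- the threshold is `2 k ^ 2`.
theorem card_manyWalks_le {k : ℕ} (hd : 1 ≤ d) (hM : 4 * d ^ 2 * k ≤ M) (hk : 1 ≤ k)
    (S₀ : Finset (Fin n)) (hS₀ : S₀.card ≤ k) :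
    ((Finset.univ.filter (fun g : Fin n → {s : Finset (Fin M) // s.card = d} =>
      ManyWalks (fun j => (g j).1) k S₀)).card : ℝ)
      ≤ 1 / k * Fintype.card (Fin n → {s : Finset (Fin M) // s.card = d}) := by
  have hk' : (0 : ℝ) < k := by exact_mod_cast hk
  set G : ℝ := (Fintype.card (Fin n → {s : Finset (Fin M) // s.card = d}) : ℝ) with hG
  have hG0 : 0 ≤ G := Nat.cast_nonneg _
  set F : (Fin n → {s : Finset (Fin M) // s.card = d}) → ℝ := fun g =>
    ∑ j ∈ S₀, walks (fun j => (g j).1) k (S₀.erase j) j with hF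
  have hF0 : ∀ g, 0 ≤ F g := fun g => Finset.sum_nonneg fun j _ => by
    linarith [one_le_walks (fun j => (g j).1) k (S₀.erase j) j]
  have h1 : ∑ g, F g ≤ k * (2 * G) := by
    rw [hF, Finset.sum_comm]
    calc _ ≤ ∑ j ∈ S₀, 2 * G := Finset.sum_le_sum fun j hj =>
          sum_walks_le hd hM k (S₀.erase j) j (Finset.notMem_erase _ _)
            ((Finset.card_le_card (Finset.erase_subset _ _)).trans hS₀)
      _ = S₀.card * (2 * G) := by rw [Finset.sum_const, nsmul_eq_mul]
      _ ≤ _ := by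
          refine mul_le_mul_of_nonneg_right ?_ (by positivity)
          exact_mod_cast hS₀
  have h2 : ((Finset.univ.filter (fun g : Fin n → {s : Finset (Fin M) // s.card = d} =>
      ManyWalks (fun j => (g j).1) k S₀)).card : ℝ) * (2 * (k : ℝ) ^ 2) ≤ ∑ g, F g := by
    rw [← nsmul_eq_mul, ← Finset.sum_const]
    refine (Finset.sum_le_sum fun g hg => ?_).trans
      (Finset.sum_le_sum_of_subset_of_nonneg (Finset.filter_subset _ _) fun g _ _ => hF0 g)
    exact (Finset.mem_filter.1 hg).2.le
  have h3 := h2.trans h1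
  rw [div_mul_eq_mul_div, one_mul, le_div_iff₀ hk']
  have : (0 : ℝ) < 2 * k := by positivity
  refine le_of_mul_le_mul_right ?_ this
  linarith

end SHOFA

/-! ### Rounding errors of the single operations -/

namespace SHOFA

open Real

variable {n M d B k : ℕ}

/-- Bound for the error of a residual at the end of a run with rounding errors `ε`. -/
noncomputable def errBound (k : ℕ) (ε X : ℝ) : ℝ := 8 * ε * X * (1 + 8 * (k : ℝ) ^ 2)

/-- The arithmetic rounds with error at most `ε` on the range that is needed for entries of modulus
between `η` and `X`, and the tolerance lies between the errors and the resolution of the phases. -/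
structure Regime (ar : Arith) (n k B : ℕ) (ε X η : ℝ) : Prop where
  two_le : 2 ≤ n
  one_le_k : 1 ≤ k
  k_le : k ≤ n
  eps_nonneg : 0 ≤ ε
  acc : ∀ r, |r| ≤ 100 * n * X → |ar.rnd r - r| ≤ ε
  one_le_X : 1 ≤ X
  eta_pos : 0 < η
  eta_le : η ≤ 1
  err_le : 1000 * n * errBound k ε X ≤ ar.tol * η
  tol_le : 16 * ar.tol * 2 ^ B ≤ η

namespace Regime

variable {ar : Arith} {ε X η : ℝ} (h : Regime ar n k B ε X η)
include h

theorem two_le_cast : (2 : ℝ) ≤ n := by exact_mod_cast h.two_le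

theorem le_errBound : 8 * ε * X ≤ errBound k ε X := by
  have h1 := mul_nonneg h.eps_nonneg (zero_le_one.trans h.one_le_X)
  unfold errBound
  nlinarith [sq_nonneg (k : ℝ)]

theorem eps_mul_le : ε ≤ ε * X := le_mul_of_one_le_right h.eps_nonneg h.one_le_X

theorem eps_le : 8 * ε ≤ errBound k ε X := by linarith [h.le_errBound, h.eps_mul_le]

theorem errBound_nonneg : 0 ≤ errBound k ε X := by linarith [h.eps_le, h.eps_nonneg]

theorem tol_nonneg : 0 ≤ ar.tol := by
  by_contra! ht
  have := mul_neg_of_neg_of_pos ht h.eta_pos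
  have := mul_nonneg (mul_nonneg (by norm_num : (0 : ℝ) ≤ 1000) (Nat.cast_nonneg n))
    h.errBound_nonneg
  linarith [h.err_le]

theorem tol_le_eta : 16 * ar.tol ≤ η := by
  have h1 : (1 : ℝ) ≤ 2 ^ B := one_le_pow₀ (by norm_num)
  have h2 : 16 * ar.tol * 1 ≤ 16 * ar.tol * 2 ^ B :=
    mul_le_mul_of_nonneg_left h1 (by linarith [h.tol_nonneg])
  linarith [h.tol_le]

theorem n_mul_errBound_le : 1000 * (n * errBound k ε X) ≤ ar.tol := by
  have := mul_le_mul_of_nonneg_left h.eta_le h.tol_nonneg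
  linarith [h.err_le]

theorem errBound_le : 2000 * errBound k ε X ≤ ar.tol := by
  have := mul_le_mul_of_nonneg_right h.two_le_cast h.errBound_nonneg
  linarith [h.n_mul_errBound_le]

theorem n_mul_le : (n : ℝ) ≤ n * X := le_mul_of_one_le_right (Nat.cast_nonneg n) h.one_le_X

theorem X_mul_le : 2 * X ≤ n * X :=
  mul_le_mul_of_nonneg_right h.two_le_cast (zero_le_one.trans h.one_le_X)

theorem norm_rndC_sub_le {z : ℂ} (hz : ‖z‖ ≤ 100 * n * X) : ‖ar.rndC z - z‖ ≤ 2 * ε := by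
  refine (Complex.norm_le_abs_re_add_abs_im _).trans ?_
  have h1 := h.acc z.re ((Complex.abs_re_le_norm z).trans hz)
  have h2 := h.acc z.im ((Complex.abs_im_le_norm z).trans hz)
  simp only [Complex.sub_re, Complex.sub_im, Arith.rndC]
  linarith

theorem norm_rndC_unit_sub_le {a : ℂ} (ha : ‖a‖ = 1) : ‖ar.rndC a - a‖ ≤ 2 * ε :=
  h.norm_rndC_sub_le (by rw [ha]; nlinarith [h.X_mul_le, h.one_le_X])

theorem norm_rndC_unit_mul_sub_le {a : ℂ} (ha : ‖a‖ = 1) {v V : ℝ} (hv : |v| ≤ V)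
    (hV : V ≤ 40 * n * X) : ‖ar.rndC (ar.rndC a * v) - a * v‖ ≤ 2 * ε * V + 2 * ε := by
  have h1 := h.norm_rndC_unit_sub_le ha
  have hV0 : 0 ≤ V := (abs_nonneg v).trans hv
  have hnv : ‖(v : ℂ)‖ ≤ V := by rwa [Complex.norm_real, Real.norm_eq_abs]
  have h2 : ‖ar.rndC a * v - a * v‖ ≤ 2 * ε * V := by
    rw [← sub_mul, norm_mul]
    exact mul_le_mul h1 hnv (norm_nonneg _) (by linarith [h.eps_nonneg])
  have h3 : ‖a * v‖ ≤ V := by rw [norm_mul, ha, one_mul]; exact hnv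
  have h4 : ‖ar.rndC a * v‖ ≤ 2 * V := by
    have := norm_le_norm_add_norm_sub' (ar.rndC a * v) (a * v)
    have : 2 * ε * V ≤ 1 * V := mul_le_mul_of_nonneg_right
      (by linarith [h.eps_le, h.errBound_le, h.tol_le_eta, h.eta_le, h.tol_nonneg]) hV0
    linarith
  have h5 := h.norm_rndC_sub_le (z := ar.rndC a * v) (by linarith [h.n_mul_le])
  calc _ = ‖(ar.rndC (ar.rndC a * v) - ar.rndC a * v) + (ar.rndC a * v - a * v)‖ := by ring_nf
    _ ≤ _ := (norm_add_le _ _).trans (by linarith)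

theorem errBound_le_one : errBound k ε X ≤ 1 / 1000 := by
  linarith [h.errBound_le, h.tol_le_eta, h.eta_le, h.errBound_nonneg]

theorem half_le_norm_rndC {a : ℂ} (ha : ‖a‖ = 1) : 1 / 2 ≤ ‖ar.rndC a‖ := by
  have h1 := h.norm_rndC_unit_sub_le ha
  have h2 := norm_le_norm_add_norm_sub (ar.rndC a) a
  linarith [h.eps_le, h.errBound_le_one]

end Regime

theorem norm_coefI (j : Fin n) : ‖coefI j‖ = 1 := Complex.norm_exp_ofReal_mul_I _

theorem norm_coefV (ω : Design n M d B) (i : Fin M) (j : Fin n) : ‖coefV ω i j‖ = 1 :=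
  Complex.norm_exp_ofReal_mul_I _

namespace Regime

variable {ar : Arith} {ε X η : ℝ} (h : Regime ar n k B ε X η)
include h

/-- Division by the rounded coefficient, of modulus at least `1 / 2`, at most doubles the residual
error; this is the origin of the weight two in `walks`. Taking the real part costs nothing, as `x`
is real. -/
theorem abs_entry_sub_le {u : ℂ} {x ρ : ℝ} (j : Fin n) (hu : ‖u - x * coefI j‖ ≤ ρ)
    (hρ : ρ ≤ 1) (hx : |x| ≤ X) : |entry ar u j - x| ≤ 2 * ρ + 8 * ε * X := by
  set a := coefI j with ha
  have h1 := h.norm_rndC_unit_sub_le (norm_coefI j)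
  have h2 := h.half_le_norm_rndC (norm_coefI j)
  rw [← ha] at h1 h2
  have hne : ar.rndC a ≠ 0 := by
    rw [← norm_pos_iff]; linarith
  have hnx : ‖(x : ℂ)‖ ≤ X := by rwa [Complex.norm_real, Real.norm_eq_abs]
  have h3 : u / ar.rndC a - x = ((u - x * a) - x * (ar.rndC a - a)) / ar.rndC a := by
    field_simp; ring
  have h4 : ‖u / ar.rndC a - x‖ ≤ 2 * ρ + 4 * ε * X := by
    rw [h3, norm_div, div_le_iff₀ (by linarith)]
    have h5 : ‖(u - x * a) - x * (ar.rndC a - a)‖ ≤ ρ + X * (2 * ε) := by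
      refine (norm_sub_le _ _).trans (add_le_add hu ?_)
      rw [norm_mul]
      exact mul_le_mul hnx h1 (norm_nonneg _) (by linarith [h.one_le_X])
    have h6 : 0 ≤ ρ := (norm_nonneg _).trans hu
    have h7 := mul_nonneg h.eps_nonneg (zero_le_one.trans h.one_le_X)
    nlinarith
  have h8 : ‖u / ar.rndC a‖ ≤ 100 * n * X := by
    have := norm_le_norm_add_norm_sub' (u / ar.rndC a) (x : ℂ)
    nlinarith [h.le_errBound, h.errBound_le_one, h.X_mul_le, h.one_le_X]
  have h9 := h.acc _ ((Complex.abs_re_le_norm _).trans h8)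
  have h10 := (Complex.abs_re_le_norm (u / ar.rndC a - x)).trans h4
  rw [Complex.sub_re, Complex.ofReal_re] at h10
  have h11 : entry ar u j - x = (ar.rnd (u / ar.rndC a).re - (u / ar.rndC a).re)
    + ((u / ar.rndC a).re - x) := by simp [entry, Arith.rndC, ha]
  rw [h11]
  refine (abs_add_le _ _).trans ?_
  linarith [h.eps_mul_le, h.eps_nonneg]

/-- A crude bound for an arbitrary candidate, needed to control the rounding at a node that is not a
leaf, where the value has no meaning. -/
theorem abs_entry_le {u : ℂ} (j : Fin n) (hu : ‖u‖ ≤ 2 * n * X) :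
    |entry ar u j| ≤ 5 * n * X := by
  have h2 := h.half_le_norm_rndC (norm_coefI j)
  have h4 : ‖u / ar.rndC (coefI j)‖ ≤ 4 * n * X := by
    rw [norm_div, div_le_iff₀ (by linarith)]
    nlinarith [h.n_mul_le, h.two_le_cast]
  have h9 := h.acc (u / ar.rndC (coefI j)).re ((Complex.abs_re_le_norm _).trans
    (by nlinarith [h.n_mul_le, h.two_le_cast]))
  have h10 := (Complex.abs_re_le_norm (u / ar.rndC (coefI j))).trans h4
  have h11 : entry ar u j = (ar.rnd (u / ar.rndC (coefI j)).re - (u / ar.rndC (coefI j)).re)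
    + (u / ar.rndC (coefI j)).re := by simp [entry, Arith.rndC]
  rw [h11]
  refine (abs_add_le _ _).trans ?_
  nlinarith [h.eps_le, h.errBound_le_one, h.n_mul_le, h.two_le_cast]

/-- The coefficient has modulus one, so the error of `v` enters the residual without amplification.
The roundings of the coefficient, the product and the difference fit into `8 * ε * X`. -/
theorem norm_reduce_sub_le {a u w : ℂ} {x v ρ : ℝ} (ha : ‖a‖ = 1) (hu : ‖u - w‖ ≤ ρ)
    (hρ : ρ ≤ 1) (hw : ‖w‖ ≤ n * X) (hx : |x| ≤ X) (hv : |v - x| ≤ 1) :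
    ‖reduce ar a v u - (w - x * a)‖ ≤ ρ + (|v - x| + 8 * ε * X) := by
  have hX := h.one_le_X
  have hv2 : |v| ≤ 2 * X := by
    have := abs_sub_abs_le_abs_sub v x
    linarith
  have h1 := h.norm_rndC_unit_mul_sub_le ha hv2 (by nlinarith [h.X_mul_le])
  set p := ar.rndC (ar.rndC a * v) with hp
  have h2 : ‖a * v‖ ≤ 2 * X := by
    rw [norm_mul, ha, one_mul, Complex.norm_real, Real.norm_eq_abs]; exact hv2
  have hε := h.eps_mul_le
  have hεX := h.le_errBound
  have hE := h.errBound_le_one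
  have h3 : ‖u - p‖ ≤ 100 * n * X := by
    have e1 : u - p = (u - w) + w - (p - a * v) - a * v := by ring
    rw [e1]
    refine (norm_sub_le _ _).trans ?_
    have := norm_sub_le ((u - w) + w) (p - a * v)
    have := norm_add_le (u - w) w
    nlinarith [h.X_mul_le]
  have h4 := h.norm_rndC_sub_le h3
  have e2 : reduce ar a v u - (w - x * a) =
      (ar.rndC (u - p) - (u - p)) + (u - w) - (p - a * v) - a * ((v - x : ℝ) : ℂ) := by
    simp only [reduce, ← hp]; push_cast; ring
  have h5 : ‖a * ((v - x : ℝ) : ℂ)‖ = |v - x| := by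
    rw [norm_mul, ha, one_mul, Complex.norm_real, Real.norm_eq_abs]
  rw [e2]
  have t1 := norm_sub_le ((ar.rndC (u - p) - (u - p)) + (u - w) - (p - a * v))
    (a * ((v - x : ℝ) : ℂ))
  have t2 := norm_sub_le ((ar.rndC (u - p) - (u - p)) + (u - w)) (p - a * v)
  have t3 := norm_add_le (ar.rndC (u - p) - (u - p)) (u - w)
  linarith

/-- Completeness of the verification: at a genuine leaf all errors add up to a few multiples of
`errBound`, which is at most `ar.tol / 2000`. -/
theorem discrepancy_le {a w : ℂ} {x v : ℝ} (ha : ‖a‖ = 1) (hx : |x| ≤ X)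
    (hw : ‖w - x * a‖ ≤ errBound k ε X) (hv : |v - x| ≤ 3 * errBound k ε X) :
    discrepancy ar a v w ≤ ar.tol := by
  have hX := h.one_le_X
  have hε := h.eps_mul_le
  have hεX := h.le_errBound
  have hE := h.errBound_le_one
  have hE' := h.errBound_le
  have hE0 := h.errBound_nonneg
  have hε8 := h.eps_le
  have hv2 : |v| ≤ 2 * X := by
    have := abs_sub_abs_le_abs_sub v x
    linarith
  have h1 := h.norm_rndC_unit_mul_sub_le ha hv2 (by nlinarith [h.X_mul_le])
  set p := ar.rndC (ar.rndC a * v) with hp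
  have h5 : ‖a * ((v - x : ℝ) : ℂ)‖ = |v - x| := by
    rw [norm_mul, ha, one_mul, Complex.norm_real, Real.norm_eq_abs]
  have h6 : ‖p - w‖ ≤ 5 * errBound k ε X := by
    have e1 : p - w = (p - a * v) + a * ((v - x : ℝ) : ℂ) - (w - x * a) := by push_cast; ring
    rw [e1]
    have t1 := norm_sub_le ((p - a * v) + a * ((v - x : ℝ) : ℂ)) (w - x * a)
    have t2 := norm_add_le (p - a * v) (a * ((v - x : ℝ) : ℂ))
    linarith
  have h7 := h.norm_rndC_sub_le (z := p - w) (by nlinarith [h.X_mul_le])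
  have h8 : ‖ar.rndC (p - w)‖ ≤ 6 * errBound k ε X := by
    have := norm_le_norm_add_norm_sub' (ar.rndC (p - w)) (p - w)
    linarith
  have h9 := h.acc ‖ar.rndC (p - w)‖ (by rw [abs_norm]; nlinarith [h.X_mul_le])
  rw [abs_le] at h9
  unfold discrepancy
  rw [← hp]
  linarith [h9.2]

/-- Soundness of the verification: a test passed in rounded arithmetic forces a near-identity
between unrounded quantities, to which the randomness of the phases applies. As `v` may be of order
`n * X`, the factor `n` in `Regime.err_le` is needed. -/
theorem norm_le_of_discrepancy_le {a w W : ℂ} {v : ℝ} (ha : ‖a‖ = 1) (hv : |v| ≤ 5 * n * X)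
    (hw : ‖w - W‖ ≤ errBound k ε X) (hW : ‖W‖ ≤ n * X) (hd : discrepancy ar a v w ≤ ar.tol) :
    ‖a * v - W‖ ≤ 2 * ar.tol := by
  have hX := h.one_le_X
  have hε := h.eps_mul_le
  have hε0 := h.eps_nonneg
  have hεX := h.le_errBound
  have hE := h.errBound_le_one
  have hE' := h.errBound_le
  have hE0 := h.errBound_nonneg
  have hε8 := h.eps_le
  have hnX := h.X_mul_le
  have h1 := h.norm_rndC_unit_mul_sub_le ha hv (by nlinarith)
  set p := ar.rndC (ar.rndC a * v) with hp
  have h2 : ‖a * v‖ ≤ 5 * n * X := by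
    rw [norm_mul, ha, one_mul, Complex.norm_real, Real.norm_eq_abs]; exact hv
  have h3 : 2 * ε * (5 * n * X) ≤ 2 * (n * errBound k ε X) := by
    have := mul_le_mul_of_nonneg_left hεX (Nat.cast_nonneg n)
    have : 0 ≤ n * (ε * X) := mul_nonneg (Nat.cast_nonneg n) (by linarith)
    nlinarith
  have hnE := h.n_mul_errBound_le
  have htol : ar.tol ≤ 1 / 16 := by linarith [h.tol_le_eta, h.eta_le]
  have e1 : p - w = (p - a * v) + a * v - (w - W) - W := by ring
  have h4 : ‖p - w‖ ≤ 10 * n * X := by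
    rw [e1]
    have t1 := norm_sub_le ((p - a * v) + a * v - (w - W)) W
    have t2 := norm_sub_le ((p - a * v) + a * v) (w - W)
    have t3 := norm_add_le (p - a * v) (a * v)
    nlinarith
  have h7 := h.norm_rndC_sub_le (z := p - w) (by nlinarith)
  have h8 : ‖ar.rndC (p - w)‖ ≤ 100 * n * X := by
    have := norm_le_norm_add_norm_sub' (ar.rndC (p - w)) (p - w)
    nlinarith
  have h9 := h.acc ‖ar.rndC (p - w)‖ (by rw [abs_norm]; exact h8)
  rw [abs_le] at h9
  unfold discrepancy at hd
  rw [← hp] at hd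
  have e2 : a * v - W = -(p - a * v) - (ar.rndC (p - w) - (p - w)) + (w - W)
    + ar.rndC (p - w) := by ring
  rw [e2]
  have t1 := norm_add_le (-(p - a * v) - (ar.rndC (p - w) - (p - w)) + (w - W)) (ar.rndC (p - w))
  have t2 := norm_add_le (-(p - a * v) - (ar.rndC (p - w) - (p - w))) (w - W)
  have t3 := norm_sub_le (-(p - a * v)) (ar.rndC (p - w) - (p - w))
  rw [norm_neg] at t3
  linarith [h9.1]

theorem candidate_eq_none {N : Fin n → Finset (Fin M)} {u : ℂ} (i : Fin M)
    (hu : ‖u‖ ≤ errBound k ε X) : candidate ar N u i = none := by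
  unfold candidate
  rw [if_pos]
  have h9 := h.acc ‖u‖ (by
    rw [abs_norm]; nlinarith [h.X_mul_le, h.one_le_X, h.errBound_le_one])
  rw [abs_le] at h9
  linarith [h9.2, h.eps_le, h.errBound_le, h.errBound_nonneg]

end Regime

theorem toNode_add_one (j : Fin n) : toNode n ((j : ℤ) + 1) = some j := by
  unfold toNode
  have : (1 : ℤ) ≤ (j : ℤ) + 1 ∧ ((j : ℤ) + 1 : ℤ) ≤ n := by have := j.2; omega
  rw [dif_pos this]
  congr
  simp

/-- The phase of a perturbed multiple of a unit complex number. -/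
theorem abs_arg_sub_le {u : ℂ} {r θ τ : ℝ} (hr : 0 < r)
    (hu : ‖u - r * Complex.exp (θ * Complex.I)‖ ≤ τ * r) (hτ : τ ≤ 1 / 2)
    (h1 : -π < θ - 3 / 2 * τ) (h2 : θ + 3 / 2 * τ ≤ π) : |u.arg - θ| ≤ 3 / 2 * τ := by
  set a := Complex.exp (θ * Complex.I) with ha
  have hna : ‖a‖ = 1 := Complex.norm_exp_ofReal_mul_I _
  have ha0 : a ≠ 0 := Complex.exp_ne_zero _
  have hr0 : (r : ℂ) ≠ 0 := by exact_mod_cast hr.ne'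
  -- With the relative perturbation `z`, `u = r * a * (1 + z)`. The phase moves by the imaginary
  -- part of `log (1 + z)`, at most `3 / 2 * ‖z‖`, and the last two hypotheses keep the sum of the
  -- arguments off the branch cut.
  set z := (u - r * a) / (r * a) with hz
  have hnz : ‖z‖ ≤ τ := by
    rw [hz, norm_div, norm_mul, hna, mul_one, Complex.norm_real, Real.norm_of_nonneg hr.le,
      div_le_iff₀ hr]
    exact hu
  have hτ0 : 0 ≤ τ := (norm_nonneg _).trans hnz
  have hlog := Complex.norm_log_one_add_half_le_self (hnz.trans hτ)
  have hargz : |(1 + z).arg| ≤ 3 / 2 * τ := by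
    rw [← Complex.log_im]
    exact (Complex.abs_im_le_norm _).trans (hlog.trans (by linarith))
  have hz1 : 1 + z ≠ 0 := by
    intro h0
    have : z = -1 := by linear_combination h0
    rw [this] at hnz
    simp at hnz
    linarith
  have harga : a.arg = θ := by
    rw [ha, Complex.arg_exp_mul_I, toIocMod_eq_self]
    constructor
    · linarith
    · linarith
  have hu' : u = r * (a * (1 + z)) := by rw [hz]; field_simp; ring
  rw [abs_le] at hargz
  rw [hu', Complex.arg_real_mul _ hr, Complex.arg_mul ha0 hz1, harga, abs_le]
  · constructor <;> linarith
  · rw [harga]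
    constructor <;> linarith

set_option maxHeartbeats 800000 in
-- The relative error of the residual is at most `τ = errBound / η`, so its phase is off by `3 / 2 *
-- τ`. Scaling by `2 n / π` turns this into an error of order `n * τ`, far below the tolerance, and
-- rounding to the nearest integer recovers the number of the node.
theorem Regime.candidate_eq_some {ar : Arith} {ε X η : ℝ} (h : Regime ar n k B ε X η)
    {N : Fin n → Finset (Fin M)} {u : ℂ} {i : Fin M} {j : Fin n} {x : ℝ} (hij : i ∈ N j)
    (hu : ‖u - x * coefI j‖ ≤ errBound k ε X) (hxη : η ≤ |x|) (hxX : |x| ≤ X) :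
    candidate ar N u i = some j := by
  have hX := h.one_le_X
  have hε0 := h.eps_nonneg
  have hE := h.errBound_le_one
  have hE' := h.errBound_le
  have hE0 := h.errBound_nonneg
  have hε8 := h.eps_le
  have hnX := h.X_mul_le
  have htol := h.tol_le_eta
  have hη := h.eta_le
  have hη0 := h.eta_pos
  have hn := h.two_le_cast
  have htol0 := h.tol_nonneg
  set E := errBound k ε X with hEdef
  set τ := E / η with hτ
  have hτ0 : 0 ≤ τ := by positivity
  have hEτ : E ≤ τ := by rw [hτ, le_div_iff₀ hη0]; nlinarith
  have hnτ : 1000 * (n * τ) ≤ ar.tol := by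
    have := h.err_le
    rw [hτ, ← mul_div_assoc, ← mul_div_assoc, div_le_iff₀ hη0]
    linarith
  have hτs : 2000 * τ ≤ ar.tol := by nlinarith
  have hx0 : x ≠ 0 := by
    intro h0; rw [h0, abs_zero] at hxη; linarith
  have hEx : E ≤ τ * |x| := by
    have : E = τ * η := by rw [hτ]; field_simp
    rw [this]; exact mul_le_mul_of_nonneg_left hxη hτ0
  set ψ₀ : ℝ := ((j : ℕ) + 1 : ℝ) * π / (2 * n) with hψ₀
  have hn0 : (0 : ℝ) < n := by linarith
  have hπ := Real.pi_gt_three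
  have hπ4 := Real.pi_le_four
  -- All node phases lie in `(0, π / 2]` and stay away from zero by more than the errors, so the
  -- sign of the computed phase reveals the sign of the entry.
  have hψlow : 1.5 / n ≤ ψ₀ := by
    rw [hψ₀, div_le_div_iff₀ hn0 (by positivity)]
    have hj : (0 : ℝ) ≤ (j : ℕ) := Nat.cast_nonneg _
    have h3 : 3 ≤ ((j : ℕ) + 1 : ℝ) * π := by nlinarith
    have := mul_le_mul_of_nonneg_right h3 hn0.le
    linarith
  have hψhigh : ψ₀ ≤ π / 2 := by
    rw [hψ₀, div_le_div_iff₀ (by positivity) (by norm_num)]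
    have : ((j : ℕ) : ℝ) + 1 ≤ n := by exact_mod_cast j.2
    nlinarith
  have hτψ : 100 * τ ≤ ψ₀ := by
    refine le_trans ?_ hψlow
    rw [le_div_iff₀ hn0]
    linarith
  have hεψ : 10 * ε ≤ ψ₀ := by linarith
  have hψpos : 0 < ψ₀ := lt_of_lt_of_le (by positivity) hψlow
  have ha : coefI j = Complex.exp (ψ₀ * Complex.I) := by
    rw [hψ₀, coefI]
  have hR : ∀ r : ℝ, |r| ≤ 50 * n → |ar.rnd r - r| ≤ ε := fun r hr =>
    h.acc r (hr.trans (by nlinarith [h.n_mul_le]))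
  set φ := ar.rnd u.arg with hφ
  have hargR : |ar.rnd u.arg - u.arg| ≤ ε := hR _ ((Complex.abs_arg_le_pi u).trans (by linarith))
  rw [← hφ] at hargR
  have hπR : |ar.rnd π - π| ≤ ε := hR _ (by rw [abs_of_pos Real.pi_pos]; linarith)
  have hangle : |(if φ < 0 then ar.rnd (φ + ar.rnd π) else φ) - ψ₀| ≤ 3 / 2 * τ + 3 * ε := by
    rcases lt_or_gt_of_ne hx0 with hx | hx
    · have h1 : |u.arg - (ψ₀ - π)| ≤ 3 / 2 * τ := by
        apply abs_arg_sub_le (r := |x|) (abs_pos.2 hx0)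
        · have : ((|x| : ℝ) : ℂ) * Complex.exp ((ψ₀ - π : ℝ) * Complex.I) = x * coefI j := by
            rw [ha, abs_of_neg hx]
            push_cast
            rw [sub_mul, Complex.exp_sub, Complex.exp_pi_mul_I]
            ring
          rw [this]; linarith
        · linarith
        · linarith
        · linarith
      rw [abs_le] at h1 hargR
      have hφneg : φ < 0 := by linarith [h1.2, hargR.2]
      rw [if_pos hφneg]
      have h2 : |ar.rnd (φ + ar.rnd π) - (φ + ar.rnd π)| ≤ ε := hR _ (by
        rw [abs_le] at hπR ⊢
        constructor <;> linarith [h1.1, h1.2, hargR.1, hargR.2, hπR.1, hπR.2])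
      rw [abs_le] at h2 hπR ⊢
      constructor <;> linarith [h1.1, h1.2, hargR.1, hargR.2, hπR.1, hπR.2, h2.1, h2.2]
    · have h1 : |u.arg - ψ₀| ≤ 3 / 2 * τ := by
        apply abs_arg_sub_le (r := |x|) (abs_pos.2 hx0)
        · rw [abs_of_pos hx, ← ha]
          rw [abs_of_pos hx] at hEx; linarith
        · linarith
        · linarith
        · linarith
      rw [abs_le] at h1 hargR
      have hφpos : ¬ φ < 0 := by push Not; linarith [h1.1, hargR.1]
      rw [if_neg hφpos, abs_le]
      constructor <;> linarith [h1.1, h1.2, hargR.1, hargR.2]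
  set ψ := (if φ < 0 then ar.rnd (φ + ar.rnd π) else φ) with hψ
  have hnπ : 2 * (n : ℝ) / π ≤ n := by
    rw [div_le_iff₀ Real.pi_pos]; nlinarith
  have hnπ0 : 0 ≤ 2 * (n : ℝ) / π := by positivity
  have hcR : |ar.rnd (2 * n / π) - 2 * n / π| ≤ ε := hR _ (by
    rw [abs_of_nonneg hnπ0]; linarith)
  set γ := ar.rnd (2 * n / π) with hγ
  have hψγ : |ψ * γ - ((j : ℕ) + 1)| ≤ 2 * n * (3 / 2 * τ + 3 * ε) + 2 * ε := by
    have e1 : ψ * γ - ((j : ℕ) + 1) = (ψ - ψ₀) * γ + ψ₀ * (γ - 2 * n / π) := by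
      have : ψ₀ * (2 * n / π) = (j : ℕ) + 1 := by rw [hψ₀]; field_simp
      linear_combination this
    rw [e1]
    refine (abs_add_le _ _).trans ?_
    rw [abs_mul, abs_mul, abs_of_pos hψpos]
    have hγn : |γ| ≤ 2 * n := by
      rw [abs_le] at hcR ⊢
      constructor <;> linarith [hcR.1, hcR.2]
    have t1 := mul_le_mul hangle hγn (abs_nonneg _) (by linarith)
    have t2 : ψ₀ * |γ - 2 * n / π| ≤ 2 * ε :=
      mul_le_mul (by linarith) hcR (abs_nonneg _) (by norm_num)
    linarith
  have hsmall : 2 * n * (3 / 2 * τ + 3 * ε) + 3 * ε ≤ ar.tol / 100 := by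
    have h1 : n * (8 * ε) ≤ n * τ := mul_le_mul_of_nonneg_left (by linarith) hn0.le
    have h2 : 2 * n * (3 / 2 * τ + 3 * ε) = 3 * (n * τ) + 3 / 4 * (n * (8 * ε)) := by ring
    rw [h2]
    linarith
  have hj1 : ((j : ℕ) : ℝ) + 1 ≤ n := by exact_mod_cast j.2
  have hj0 : (0 : ℝ) ≤ ((j : ℕ) : ℝ) := Nat.cast_nonneg _
  have htR : |ar.rnd (ψ * γ) - ψ * γ| ≤ ε := hR _ (by
    rw [abs_le] at hψγ ⊢
    constructor <;> linarith [hψγ.1, hψγ.2])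
  set t := ar.rnd (ψ * γ) with ht
  have htj : |t - ((j : ℕ) + 1)| ≤ ar.tol / 100 := by
    have e : t - ((j : ℕ) + 1) = (t - ψ * γ) + (ψ * γ - ((j : ℕ) + 1)) := by ring
    rw [e]
    exact (abs_add_le _ _).trans (by linarith)
  have hround : round t = ((j : ℕ) : ℤ) + 1 := by
    rw [round_eq, Int.floor_eq_iff]
    push_cast
    rw [abs_le] at htj
    constructor <;> linarith [htj.1, htj.2]
  have hδ : ar.rnd |t - round t| ≤ ar.tol := by
    have e : |t - round t| = |t - ((j : ℕ) + 1)| := by rw [hround]; push_cast; rfl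
    rw [e]
    have := hR |t - ((j : ℕ) + 1)| (by rw [abs_abs]; linarith)
    rw [abs_le] at this
    linarith [this.2]
  have hzero : ¬ ar.rnd ‖u‖ ≤ ar.tol := by
    push Not
    have h1 : ‖(x : ℂ) * coefI j‖ = |x| := by
      rw [norm_mul, norm_coefI, mul_one, Complex.norm_real, Real.norm_eq_abs]
    have h2 : |x| - E ≤ ‖u‖ := by
      have := norm_le_norm_add_norm_sub u (x * coefI j)
      linarith
    have h3 : ‖u‖ ≤ |x| + E := by
      have := norm_le_norm_add_norm_sub' u (x * coefI j)
      linarith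
    have := h.acc ‖u‖ (by rw [abs_norm]; nlinarith [h.n_mul_le])
    rw [abs_le] at this
    linarith [this.1]
  unfold candidate
  rw [if_neg hzero]
  simp only [← hφ, ← hψ, ← hγ, ← ht]
  rw [if_pos hδ, hround, toNode_add_one]
  simp [hij]

end SHOFA

/-! ### Phase collisions, and the peeling run that knows the leaves -/

namespace SHOFA

open Real

variable {n M d B k : ℕ}

section Phases

/-- The unit complex numbers from which the verification weights are drawn. -/
noncomputable def phase (B : ℕ) (t : Fin (2 ^ B)) : ℂ :=
  Complex.exp ((((t : ℕ) : ℝ) / 2 ^ B * (π / 2) : ℝ) * Complex.I)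

/-- The chord of an angle `γ` is `2 sin (γ / 2) ≥ 2 γ / π` by Jordan's inequality, and the angles
are at least `π / 2 ^ (B + 1)` apart. -/
theorem inv_two_pow_le_norm_phase_sub {s t : Fin (2 ^ B)} (hst : s < t) :
    1 / 2 ^ B ≤ ‖phase B t - phase B s‖ := by
  set α : ℝ := ((s : ℕ) : ℝ) / 2 ^ B * (π / 2) with hα
  set β : ℝ := ((t : ℕ) : ℝ) / 2 ^ B * (π / 2) with hβ
  have h2B : (0 : ℝ) < 2 ^ B := by positivity
  have hπ := Real.pi_pos
  have hsub : phase B t - phase B s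
      = Complex.exp (α * Complex.I) * (Complex.exp (Complex.I * ((β - α : ℝ) : ℂ)) - 1) := by
    rw [mul_sub, ← Complex.exp_add, mul_one]
    unfold phase
    congr 2
    rw [← hβ]
    push_cast
    ring
  have hst' : ((s : ℕ) : ℝ) + 1 ≤ ((t : ℕ) : ℝ) := by exact_mod_cast hst
  have ht : ((t : ℕ) : ℝ) ≤ 2 ^ B := by exact_mod_cast t.2.le
  have hs : (0 : ℝ) ≤ ((s : ℕ) : ℝ) := Nat.cast_nonneg _
  have hd : β - α = (((t : ℕ) : ℝ) - ((s : ℕ) : ℝ)) / 2 ^ B * (π / 2) := by rw [hα, hβ]; ring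
  have hlow : 1 / 2 ^ B * (π / 2) ≤ β - α := by
    rw [hd]
    refine mul_le_mul_of_nonneg_right ?_ (by positivity)
    exact div_le_div_of_nonneg_right (by linarith) h2B.le
  have hhigh : β - α ≤ π / 2 := by
    rw [hd]
    have : (((t : ℕ) : ℝ) - ((s : ℕ) : ℝ)) / 2 ^ B ≤ 1 := by
      rw [div_le_one h2B]; linarith
    nlinarith
  have hpos : 0 ≤ β - α := le_trans (by positivity) hlow
  have hsin := Real.mul_le_sin (x := (β - α) / 2) (by linarith) (by linarith)
  rw [hsub, norm_mul, Complex.norm_exp_ofReal_mul_I, one_mul,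
    Complex.norm_exp_I_mul_ofReal_sub_one, Real.norm_eq_abs]
  refine le_trans ?_ (le_abs_self _)
  have h3 : 2 / π * (1 / 2 ^ B * (π / 2)) ≤ 2 / π * (β - α) :=
    mul_le_mul_of_nonneg_left hlow (by positivity)
  have h4 : 2 / π * (1 / 2 ^ B * (π / 2)) = 1 / 2 ^ B := by field_simp
  linarith

theorem inv_two_pow_le_norm_phase_sub_of_ne {s t : Fin (2 ^ B)} (hst : s ≠ t) :
    1 / 2 ^ B ≤ ‖phase B t - phase B s‖ := by
  rcases lt_or_gt_of_ne hst with h | h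
  · exact inv_two_pow_le_norm_phase_sub h
  · rw [norm_sub_rev]; exact inv_two_pow_le_norm_phase_sub h

open Classical in
/-- A collision of at least two entries is consistent with the entry `v` at `j₀` for at most a
fraction `2 ^ (-B)` of the phases. -/
theorem card_collision_mul_le {η τ : ℝ} (hη : 0 < η) (hτ : 16 * τ * 2 ^ B ≤ η)
    (S : Finset (Fin n)) (hS : 2 ≤ S.card) (x : Fin n → ℝ) (hx : ∀ j ∈ S, η ≤ |x j|)
    (i : Fin M) (j₀ : Fin n) (v : ℝ) :
    (Finset.univ.filter fun θ : Fin M → Fin n → Fin (2 ^ B) =>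
      ‖phase B (θ i j₀) * v - ∑ j ∈ S, x j * phase B (θ i j)‖ ≤ 2 * τ).card * 2 ^ B
      ≤ Fintype.card (Fin M → Fin n → Fin (2 ^ B)) := by
  -- Having two members, `S` contains some `j₁ ≠ j₀`, whose phase at `i` can be varied while the
  -- term with `v` stays fixed.
  obtain ⟨j₁, hj₁, hne⟩ : ∃ j₁ ∈ S, j₁ ≠ j₀ := by
    by_contra! hcon
    have : S ⊆ {j₀} := fun j hj => Finset.mem_singleton.2 (hcon j hj)
    have := Finset.card_le_card this
    simp at this
    omega
  set A := Finset.univ.filter fun θ : Fin M → Fin n → Fin (2 ^ B) =>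
      ‖phase B (θ i j₀) * v - ∑ j ∈ S, x j * phase B (θ i j)‖ ≤ 2 * τ with hA
  -- With the other phases frozen, at most one phase at `(i, j₁)` is consistent: two of them would
  -- differ in effect by at least `η / 2 ^ B`, but by at most `4 * τ ≤ η / 2 ^ B / 4`.
  have key : ∀ θ ∈ A, ∀ θ' ∈ A, (∀ i' j', (i' ≠ i ∨ j' ≠ j₁) → θ i' j' = θ' i' j') → θ = θ' := by
    intro θ hθ θ' hθ' hagree
    by_contra hneq
    have h1 : θ i j₁ ≠ θ' i j₁ := by
      intro h
      apply hneq
      funext i' j'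
      by_cases hij : i' ≠ i ∨ j' ≠ j₁
      · exact hagree i' j' hij
      · push Not at hij
        rw [hij.1, hij.2, h]
    have hθ1 := (Finset.mem_filter.1 hθ).2
    have hθ2 := (Finset.mem_filter.1 hθ').2
    rw [← Finset.add_sum_erase S _ hj₁] at hθ1 hθ2
    have h2 : ∑ j ∈ S.erase j₁, (x j : ℂ) * phase B (θ i j)
        = ∑ j ∈ S.erase j₁, (x j : ℂ) * phase B (θ' i j) :=
      Finset.sum_congr rfl fun j hj => by
        rw [hagree i j (Or.inr (Finset.ne_of_mem_erase hj))]
    rw [h2, hagree i j₀ (Or.inr hne.symm)] at hθ1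
    have h3 : ‖(x j₁ : ℂ) * (phase B (θ' i j₁) - phase B (θ i j₁))‖ ≤ 4 * τ := by
      have e : (x j₁ : ℂ) * (phase B (θ' i j₁) - phase B (θ i j₁)) =
        (phase B (θ' i j₀) * v - (x j₁ * phase B (θ i j₁) +
          ∑ j ∈ S.erase j₁, (x j : ℂ) * phase B (θ' i j))) -
        (phase B (θ' i j₀) * v - (x j₁ * phase B (θ' i j₁) +
          ∑ j ∈ S.erase j₁, (x j : ℂ) * phase B (θ' i j))) := by ring
      rw [e]
      exact (norm_sub_le _ _).trans (by linarith)
    rw [norm_mul, Complex.norm_real, Real.norm_eq_abs] at h3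
    have h4 : η * (1 / 2 ^ B) ≤ 4 * τ := (mul_le_mul (hx j₁ hj₁)
      (inv_two_pow_le_norm_phase_sub_of_ne h1) (by positivity) (abs_nonneg _)).trans h3
    have h2B : (0 : ℝ) < 2 ^ B := by positivity
    rw [mul_one_div, div_le_iff₀ h2B] at h4
    have : 0 < τ * 2 ^ B := by linarith
    linarith
  -- Hence overwriting this phase by an arbitrary one is injective on `A` times the set of phases,
  -- which bounds the density of `A`.
  have hinj : Set.InjOn (fun p : (Fin M → Fin n → Fin (2 ^ B)) × Fin (2 ^ B) =>
      Function.update p.1 i (Function.update (p.1 i) j₁ p.2))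
      ((A ×ˢ Finset.univ : Finset ((Fin M → Fin n → Fin (2 ^ B)) × Fin (2 ^ B))) : Set _) := by
    rintro ⟨θ, b⟩ hp ⟨θ', b'⟩ hp' heq
    simp only [Finset.coe_product, Set.mem_prod, Finset.mem_coe] at hp hp'
    simp only at heq
    have hb : b = b' := by simpa using congrFun (congrFun heq i) j₁
    have : θ = θ' := by
      refine key θ hp.1 θ' hp'.1 fun i' j' hij => ?_
      have h := congrFun (congrFun heq i') j'
      by_cases hi : i' = i
      · subst hi
        have hj : j' ≠ j₁ := by tauto
        simpa [hj] using h
      · simpa [hi] using h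
    rw [this, hb]
  have h := Finset.card_le_card_of_injOn _ (fun p _ => Finset.mem_univ _) hinj
  rw [Finset.card_product, Finset.card_univ, Fintype.card_fin, Finset.card_univ] at h
  exact h

end Phases

/-- The part of the state of the decoder that does not depend on the phases, with the set of the
entries that are not yet decoded. -/
structure PeelState (n M : ℕ) where
  resI : Fin M → ℂ
  xhat : Fin n → ℝ
  rest : Finset (Fin n)

/-- A peeling iteration of a decoder that knows the leaves. -/
noncomputable def PeelState.next (ar : Arith) (N : Fin n → Finset (Fin M))
    (pick : ℕ → Finset (Fin M) → Fin M) (t : ℕ) (st : PeelState n M) : PeelState n M :=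
  if leaves N st.rest = ∅ then st else
    match candidate ar N (st.resI (pick t (leaves N st.rest))) (pick t (leaves N st.rest)) with
    | none => st
    | some j =>
      let v := entry ar (st.resI (pick t (leaves N st.rest))) j
      ⟨fun i => if i ∈ N j then reduce ar (coefI j) v (st.resI i) else st.resI i,
        Function.update st.xhat j v, st.rest.erase j⟩

/-- The state of the decoder that knows the leaves after `t` iterations. -/
noncomputable def PeelState.run (ar : Arith) (N : Fin n → Finset (Fin M))
    (pick : ℕ → Finset (Fin M) → Fin M) (st : PeelState n M) : ℕ → PeelState n M
  | 0 => st
  | t + 1 => (PeelState.run ar N pick st t).next ar N pick t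

/-- Sum of the contributions of the entries in `S` to the right node `i`, with weights `a`. -/
noncomputable def contrib (N : Fin n → Finset (Fin M)) (x : Fin n → ℝ) (S : Finset (Fin n))
    (a : Fin n → ℂ) (i : Fin M) : ℂ :=
  ∑ j ∈ S.filter (i ∈ N ·), x j * a j

/-- Bound for the error of the residual at `i` due to the entries in `D`, where `δ` is the rounding
error of a subtraction. -/
noncomputable def drift (N : Fin n → Finset (Fin M)) (x xhat : Fin n → ℝ) (D : Finset (Fin n))
    (δ : ℝ) (i : Fin M) : ℝ :=
  ∑ j ∈ D.filter (i ∈ N ·), (|xhat j - x j| + δ)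

/-- Neighbourhoods `N` for which peeling the support `S₀` of `x` succeeds. -/
structure Peelable (N : Fin n → Finset (Fin M)) (k : ℕ) (x : Fin n → ℝ) (X η : ℝ)
    (S₀ : Finset (Fin n)) : Prop where
  mem_iff : ∀ j, j ∈ S₀ ↔ x j ≠ 0
  card_le : S₀.card ≤ k
  eta_le : ∀ j ∈ S₀, η ≤ |x j|
  le_X : ∀ j, |x j| ≤ X
  walks_le : ¬ ManyWalks N k S₀
  leafy : ¬ Leafless N S₀

/-- The state of a run in which the errors are bounded by the number of walks. -/
structure PeelState.Sound (N : Fin n → Finset (Fin M)) (x : Fin n → ℝ) (S₀ : Finset (Fin n))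
    (δ : ℝ) (st : PeelState n M) : Prop where
  rest_subset : st.rest ⊆ S₀
  xhat_eq_zero : ∀ j, j ∉ S₀ \ st.rest → st.xhat j = 0
  err_le : ∀ j ∈ S₀ \ st.rest, |st.xhat j - x j| + δ ≤
    4 * δ * walks N (S₀ \ st.rest).card ((S₀ \ st.rest).erase j) j
  res_le : ∀ i, ‖st.resI i - contrib N x st.rest coefI i‖ ≤
    δ + drift N x st.xhat (S₀ \ st.rest) δ i

section Run

variable {ar : Arith} {ε X η : ℝ} {N : Fin n → Finset (Fin M)} {x : Fin n → ℝ}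
  {S₀ : Finset (Fin n)}

theorem norm_contrib_le (h : Regime ar n k B ε X η) (hp : Peelable N k x X η S₀)
    (S : Finset (Fin n)) {a : Fin n → ℂ} (ha : ∀ j, ‖a j‖ = 1) (i : Fin M) :
    ‖contrib N x S a i‖ ≤ n * X := by
  have hX : 0 ≤ X := zero_le_one.trans h.one_le_X
  refine (norm_sum_le _ _).trans ?_
  calc _ ≤ ∑ j ∈ S.filter (i ∈ N ·), X := Finset.sum_le_sum fun j _ => by
        rw [norm_mul, ha, mul_one, Complex.norm_real, Real.norm_eq_abs]; exact hp.le_X j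
    _ = ((S.filter (i ∈ N ·)).card : ℝ) * X := by rw [Finset.sum_const, nsmul_eq_mul]
    _ ≤ _ := by
        refine mul_le_mul_of_nonneg_right ?_ hX
        have := (S.filter (i ∈ N ·)).card_le_univ
        rw [Fintype.card_fin] at this
        exact_mod_cast this

theorem contrib_eq_of_filter_eq {S : Finset (Fin n)} {a : Fin n → ℂ} {i : Fin M} {j : Fin n}
    (hS : S.filter (i ∈ N ·) = {j}) : contrib N x S a i = x j * a j := by
  rw [contrib, hS, Finset.sum_singleton]

/-- Subtracting an entry from a residual adds its error to the drift. -/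
theorem norm_sub_contrib_erase_le (h : Regime ar n k B ε X η) (hp : Peelable N k x X η S₀)
    {R D : Finset (Fin n)} {a : Fin n → ℂ} (ha : ∀ j, ‖a j‖ = 1) {i : Fin M} {u : ℂ}
    {xhat : Fin n → ℝ} {v : ℝ} {j : Fin n} (hj : j ∈ R) (hjD : j ∉ D)
    (hu : ‖u - contrib N x R a i‖ ≤ 8 * ε * X + drift N x xhat D (8 * ε * X) i)
    (hu1 : 8 * ε * X + drift N x xhat D (8 * ε * X) i ≤ 1) (hv : |v - x j| ≤ 1) :
    ‖(if i ∈ N j then reduce ar (a j) v u else u) - contrib N x (R.erase j) a i‖ ≤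
      8 * ε * X + drift N x (Function.update xhat j v) (insert j D) (8 * ε * X) i := by
  have hupd : ∀ D' ⊆ D, ∑ j' ∈ D', (|Function.update xhat j v j' - x j'| + 8 * ε * X)
      = ∑ j' ∈ D', (|xhat j' - x j'| + 8 * ε * X) := fun D' hD' =>
    Finset.sum_congr rfl fun j' hj' => by
      have : j' ≠ j := fun h => hjD (h ▸ hD' hj')
      rw [Function.update_of_ne this]
  by_cases hij : i ∈ N j
  · rw [if_pos hij]
    have hjR : j ∈ R.filter (i ∈ N ·) := Finset.mem_filter.2 ⟨hj, hij⟩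
    have h1 : contrib N x (R.erase j) a i = contrib N x R a i - x j * a j := by
      unfold contrib
      rw [Finset.filter_erase, ← Finset.add_sum_erase _ _ hjR]
      ring
    have h2 : drift N x (Function.update xhat j v) (insert j D) (8 * ε * X) i =
        (|v - x j| + 8 * ε * X) + drift N x xhat D (8 * ε * X) i := by
      unfold drift
      rw [Finset.filter_insert, if_pos hij, Finset.sum_insert (by simp [hjD]),
        Function.update_self, hupd _ (Finset.filter_subset _ _)]
    rw [h1, h2]
    have := h.norm_reduce_sub_le (ha j) hu hu1 (norm_contrib_le h hp R ha i) (hp.le_X j) hv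
    linarith
  · rw [if_neg hij]
    have h1 : contrib N x (R.erase j) a i = contrib N x R a i := by
      unfold contrib
      rw [Finset.filter_erase, Finset.erase_eq_of_notMem (by simp [hij])]
    have h2 : drift N x (Function.update xhat j v) (insert j D) (8 * ε * X) i =
        drift N x xhat D (8 * ε * X) i := by
      unfold drift
      rw [Finset.filter_insert, if_neg hij, hupd _ (Finset.filter_subset _ _)]
    rw [h1, h2]
    exact hu

/-- Each decoded entry contributes at most `4 δ` times its walk count, with `δ = 8 * ε * X`. As the
walk counts total at most `2 k ^ 2`, this gives `δ (1 + 8 k ^ 2)`, whatever the order of peeling. -/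
theorem drift_le_errBound (h : Regime ar n k B ε X η) (hp : Peelable N k x X η S₀)
    {st : PeelState n M} (hs : st.Sound N x S₀ (8 * ε * X)) (i : Fin M) :
    8 * ε * X + drift N x st.xhat (S₀ \ st.rest) (8 * ε * X) i ≤ errBound k ε X := by
  have hδ : 0 ≤ 8 * ε * X := by
    have := mul_nonneg h.eps_nonneg (zero_le_one.trans h.one_le_X)
    linarith
  have h0 : ∀ j, 0 ≤ 4 * (8 * ε * X) * walks N k (S₀.erase j) j := fun j => by
    have := one_le_walks N k (S₀.erase j) j
    positivity
  have h1 : drift N x st.xhat (S₀ \ st.rest) (8 * ε * X) i ≤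
      ∑ j ∈ S₀, 4 * (8 * ε * X) * walks N k (S₀.erase j) j := by
    unfold drift
    calc _ ≤ ∑ j ∈ (S₀ \ st.rest).filter (i ∈ N ·),
          4 * (8 * ε * X) * walks N k (S₀.erase j) j := by
          refine Finset.sum_le_sum fun j hj => (hs.err_le j (Finset.mem_filter.1 hj).1).trans ?_
          refine mul_le_mul_of_nonneg_left ?_ (by linarith)
          exact walks_mono N ((Finset.card_le_card Finset.sdiff_subset).trans hp.card_le)
            (Finset.erase_subset_erase _ Finset.sdiff_subset) j
      _ ≤ _ := Finset.sum_le_sum_of_subset_of_nonneg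
          ((Finset.filter_subset _ _).trans Finset.sdiff_subset) fun j _ _ => h0 j
  rw [← Finset.mul_sum] at h1
  have h2 : ∑ j ∈ S₀, walks N k (S₀.erase j) j ≤ 2 * (k : ℝ) ^ 2 := not_lt.1 hp.walks_le
  have h3 := mul_le_mul_of_nonneg_left h2 (by linarith : 0 ≤ 4 * (8 * ε * X))
  unfold errBound
  linarith

theorem abs_xhat_sub_le (h : Regime ar n k B ε X η) (hp : Peelable N k x X η S₀)
    {st : PeelState n M} (hs : st.Sound N x S₀ (8 * ε * X)) (hr : st.rest = ∅) (j : Fin n) :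
    |st.xhat j - x j| ≤ errBound k ε X ∧ (x j = 0 → st.xhat j = 0) := by
  have hδ : 0 ≤ 8 * ε * X := by
    have := mul_nonneg h.eps_nonneg (zero_le_one.trans h.one_le_X)
    linarith
  by_cases hj : j ∈ S₀
  · refine ⟨?_, fun h0 => absurd h0 ((hp.mem_iff j).1 hj)⟩
    have h1 := hs.err_le j (by simp [hr, hj])
    have h2 : walks N (S₀ \ st.rest).card ((S₀ \ st.rest).erase j) j ≤ 2 * (k : ℝ) ^ 2 := by
      refine (walks_mono N ((Finset.card_le_card Finset.sdiff_subset).trans hp.card_le)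
            (Finset.erase_subset_erase _ Finset.sdiff_subset) j).trans ?_
      refine le_trans ?_ (not_lt.1 hp.walks_le)
      exact Finset.single_le_sum (f := fun j => walks N k (S₀.erase j) j)
        (fun j _ => by linarith [one_le_walks N k (S₀.erase j) j]) hj
    have h3 := mul_le_mul_of_nonneg_left h2 (by linarith : 0 ≤ 4 * (8 * ε * X))
    unfold errBound
    linarith
  · rw [hs.xhat_eq_zero j (by simp [hj])]
    refine ⟨?_, fun _ => rfl⟩
    have : x j = 0 := by
      by_contra hx
      exact hj ((hp.mem_iff j).2 hx)
    rw [this, sub_zero, abs_zero]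
    exact h.errBound_nonneg

/-- At a leaf the candidate is the parent, and its entry is accurate. -/
theorem exists_parent (h : Regime ar n k B ε X η) (hp : Peelable N k x X η S₀)
    {st : PeelState n M} (hs : st.Sound N x S₀ (8 * ε * X)) {i : Fin M}
    (hi : i ∈ leaves N st.rest) :
    ∃ j ∈ st.rest, i ∈ N j ∧ st.rest.filter (i ∈ N ·) = {j} ∧
      candidate ar N (st.resI i) i = some j ∧
      |entry ar (st.resI i) j - x j| ≤
        2 * (8 * ε * X + drift N x st.xhat (S₀ \ st.rest) (8 * ε * X) i) + 8 * ε * X := by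
  have h1 : (st.rest.filter (i ∈ N ·)).card = 1 := by simpa [leaves] using hi
  obtain ⟨j, hj⟩ := Finset.card_eq_one.1 h1
  have hmem : j ∈ st.rest ∧ i ∈ N j := by
    have : j ∈ st.rest.filter (i ∈ N ·) := by rw [hj]; simp
    simpa using this
  have hres := hs.res_le i
  rw [contrib_eq_of_filter_eq hj] at hres
  have hE := drift_le_errBound h hp hs i
  refine ⟨j, hmem.1, hmem.2, hj, ?_, ?_⟩
  · exact h.candidate_eq_some hmem.2 (hres.trans hE) (hp.eta_le j (hs.rest_subset hmem.1))
      (hp.le_X j)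
  · exact h.abs_entry_sub_le j hres (hE.trans (h.errBound_le_one.trans (by norm_num))) (hp.le_X j)

/-- The recursion for the error of a newly decoded entry is that of `walks`: a decoded entry
disturbs the leaf only if it shares this right node with the new entry. Peeling never stops early,
since a nonempty rest without leaves would be a leafless subset of the support. -/
theorem PeelState.Sound.next (h : Regime ar n k B ε X η) (hp : Peelable N k x X η S₀)
    {st : PeelState n M} (hs : st.Sound N x S₀ (8 * ε * X)) {pick : ℕ → Finset (Fin M) → Fin M}
    (hpick : ∀ t L, L.Nonempty → pick t L ∈ L) (t : ℕ) :
    (st.next ar N pick t).Sound N x S₀ (8 * ε * X) ∧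
      (st.next ar N pick t).rest.card ≤ st.rest.card - 1 := by
  by_cases hl : leaves N st.rest = ∅
  · have hne : st.rest = ∅ := by
      by_contra hne
      exact hp.leafy ⟨st.rest, hs.rest_subset, Finset.nonempty_iff_ne_empty.2 hne, hl⟩
    have : st.next ar N pick t = st := by unfold PeelState.next; rw [if_pos hl]
    rw [this]
    exact ⟨hs, by simp [hne]⟩
  · have hi := hpick t _ (Finset.nonempty_iff_ne_empty.2 hl)
    obtain ⟨j, hj, hij, -, hcand, hent⟩ := exists_parent h hp hs hi
    unfold PeelState.next
    rw [if_neg hl]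
    set i := pick t (leaves N st.rest) with hidef
    simp only [hcand]
    set v := entry ar (st.resI i) j with hv
    refine ⟨?_, by rw [Finset.card_erase_of_mem hj]⟩
    have hjS := hs.rest_subset hj
    have hD : S₀ \ st.rest.erase j = insert j (S₀ \ st.rest) := by
      ext a
      simp only [Finset.mem_sdiff, Finset.mem_erase, Finset.mem_insert]
      by_cases ha : a = j
      · subst ha; simp [hjS]
      · simp [ha]
    have hjD : j ∉ S₀ \ st.rest := by simp [hj]
    set D := S₀ \ st.rest with hDdef
    have hδ : 0 ≤ 8 * ε * X := by
      have := mul_nonneg h.eps_nonneg (zero_le_one.trans h.one_le_X)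
      linarith
    have hE := fun i => drift_le_errBound h hp hs i
    have hcardD : (insert j D).card = D.card + 1 := Finset.card_insert_of_notMem hjD
    refine ⟨(Finset.erase_subset _ _).trans hs.rest_subset, ?_, ?_, ?_⟩
    · intro a ha
      dsimp only at ha ⊢
      rw [hD, Finset.mem_insert, not_or] at ha
      rw [Function.update_of_ne ha.1]
      exact hs.xhat_eq_zero a ha.2
    · intro a ha
      dsimp only at ha ⊢
      rw [hD] at ha ⊢
      rw [hcardD]
      rcases Finset.mem_insert.1 ha with rfl | haD
      · rw [Function.update_self, Finset.erase_insert hjD]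
        have hdr : drift N x st.xhat D (8 * ε * X) i ≤ ∑ j' ∈ D, 4 * (8 * ε * X) *
            (if ¬ Disjoint (N a) (N j') then walks N D.card (D.erase j') j' else 0) := by
          unfold drift
          rw [Finset.sum_filter]
          refine Finset.sum_le_sum fun j' hj' => ?_
          by_cases hij' : i ∈ N j'
          · have : ¬ Disjoint (N a) (N j') := Finset.not_disjoint_iff.2 ⟨i, hij, hij'⟩
            rw [if_pos hij', if_pos this]
            exact hs.err_le j' hj'
          · rw [if_neg hij']
            have := one_le_walks N D.card (D.erase j') j'
            split_ifs
            · simp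
            · positivity
        rw [← Finset.mul_sum] at hdr
        -- The new error plus `δ` is at most `2 (δ + drift) + 2 δ = 4 δ + 2 drift`, where the drift
        -- is at most `4 δ` times the sum over first steps. This is `4 δ` times the recursive
        -- formula of `walks`.
        simp only [walks]
        linarith
      · have hne : a ≠ j := fun h => hjD (h ▸ haD)
        rw [Function.update_of_ne hne]
        refine (hs.err_le a haD).trans (mul_le_mul_of_nonneg_left ?_ (by linarith))
        exact walks_mono N (Nat.le_succ _)
          (Finset.erase_subset_erase _ (Finset.subset_insert _ _)) a
    · intro i'
      dsimp only
      rw [hD]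
      refine norm_sub_contrib_erase_le h hp norm_coefI hj hjD (hs.res_le i')
        ((hE i').trans (h.errBound_le_one.trans (by norm_num))) (hent.trans ?_)
      linarith [hE i, h.errBound_le_one, h.le_errBound]

theorem PeelState.sound_run (h : Regime ar n k B ε X η) (hp : Peelable N k x X η S₀)
    {st : PeelState n M} (hs : st.Sound N x S₀ (8 * ε * X)) {pick : ℕ → Finset (Fin M) → Fin M}
    (hpick : ∀ t L, L.Nonempty → pick t L ∈ L) (t : ℕ) :
    (st.run ar N pick t).Sound N x S₀ (8 * ε * X) ∧
      (st.run ar N pick t).rest.card ≤ st.rest.card - t := by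
  induction t with
  | zero => exact ⟨hs, le_rfl⟩
  | succ t ih =>
    have := ih.1.next h hp hpick t
    exact ⟨this.1, this.2.trans (by omega)⟩

/-- If `leaves` is empty, the run has come to its end. -/
theorem PeelState.run_eq_of_leaves_eq_empty (st : PeelState n M)
    {pick : ℕ → Finset (Fin M) → Fin M} {t : ℕ}
    (ht : leaves N (st.run ar N pick t).rest = ∅) (f : ℕ) :
    st.run ar N pick (t + f) = st.run ar N pick t := by
  induction f with
  | zero => rfl
  | succ f ih =>
    rw [← Nat.add_assoc]
    change (st.run ar N pick (t + f)).next ar N pick (t + f) = _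
    rw [ih]
    unfold PeelState.next
    rw [if_pos ht]

end Run

end SHOFA

/-! ### The actual decoder follows the idealised run -/

namespace SHOFA

open Real

variable {n M d B k : ℕ}

/-- The state after the measurements of `x` have been read. -/
noncomputable def PeelState.init (ar : Arith) (N : Fin n → Finset (Fin M)) (x : Fin n → ℝ)
    (S₀ : Finset (Fin n)) : PeelState n M :=
  ⟨fun i => ar.rndC (contrib N x S₀ coefI i), 0, S₀⟩

/-- The phases `θ` make the residual at `i` look like a single entry although there are at least
two. -/
def Collision (ar : Arith) (N : Fin n → Finset (Fin M)) (x : Fin n → ℝ) (st : PeelState n M)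
    (i : Fin M) (θ : Fin M → Fin n → Fin (2 ^ B)) : Prop :=
  2 ≤ (st.rest.filter (i ∈ N ·)).card ∧ ∃ j₀, candidate ar N (st.resI i) i = some j₀ ∧
    ‖phase B (θ i j₀) * entry ar (st.resI i) j₀ -
      contrib N x st.rest (fun j => phase B (θ i j)) i‖ ≤ 2 * ar.tol

section Coupling

variable {ar : Arith} {ε X η : ℝ} {x : Fin n → ℝ} {S₀ : Finset (Fin n)} {ω : Design n M d B}

theorem PeelState.sound_init {N : Fin n → Finset (Fin M)} (h : Regime ar n k B ε X η)
    (hp : Peelable N k x X η S₀) : (PeelState.init ar N x S₀).Sound N x S₀ (8 * ε * X) := by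
  refine ⟨subset_rfl, fun _ _ => rfl, ?_, ?_⟩
  · intro j hj
    simp [PeelState.init] at hj
  · intro i
    have h1 := h.norm_rndC_sub_le (z := contrib N x S₀ coefI i)
      ((norm_contrib_le h hp S₀ norm_coefI i).trans (by nlinarith [h.n_mul_le, h.two_le_cast]))
    have h2 : drift N x (PeelState.init ar N x S₀).xhat (S₀ \ (PeelState.init ar N x S₀).rest)
        (8 * ε * X) i = 0 := by
      simp [PeelState.init, drift]
    rw [h2]
    simp only [PeelState.init]
    linarith [h.eps_mul_le, h.eps_nonneg]

theorem leafTest_eq_some (h : Regime ar n k B ε X η) (hp : Peelable (nbrs ω) k x X η S₀)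
    {st : PeelState n M} (hs : st.Sound (nbrs ω) x S₀ (8 * ε * X)) {μ : Memory n M}
    (hI : μ.resI = st.resI)
    (hV : ∀ i, ‖μ.resV i - contrib (nbrs ω) x st.rest (coefV ω i) i‖ ≤
      8 * ε * X + drift (nbrs ω) x st.xhat (S₀ \ st.rest) (8 * ε * X) i)
    {i : Fin M} (hi : i ∈ leaves (nbrs ω) st.rest) {j : Fin n}
    (hj : candidate ar (nbrs ω) (st.resI i) i = some j) :
    (leafTest ar ω μ i).val = some (j, entry ar (st.resI i) j) := by
  obtain ⟨j', hj'r, hij', hfil, hcand, hent⟩ := exists_parent h hp hs hi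
  obtain rfl : j' = j := by rw [hcand] at hj; exact Option.some_injective _ hj
  have hE := drift_le_errBound h hp hs i
  have hdisc : discrepancy ar (coefV ω i j') (entry ar (st.resI i) j') (μ.resV i) ≤ ar.tol := by
    refine h.discrepancy_le (norm_coefV ω i j') (hp.le_X j') ?_
      (hent.trans (by linarith [h.le_errBound]))
    have := hV i
    rw [contrib_eq_of_filter_eq hfil] at this
    exact this.trans hE
  rw [val_leafTest, hI, hcand]
  dsimp only
  rw [if_pos hdisc]

/-- If no entry is left at the node, its residual is mere error and fails the test for being
nonzero. If at least two are left, passing would be a collision. -/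
theorem leafTest_eq_none (h : Regime ar n k B ε X η) (hp : Peelable (nbrs ω) k x X η S₀)
    {st : PeelState n M} (hs : st.Sound (nbrs ω) x S₀ (8 * ε * X)) {μ : Memory n M}
    (hI : μ.resI = st.resI)
    (hV : ∀ i, ‖μ.resV i - contrib (nbrs ω) x st.rest (coefV ω i) i‖ ≤
      8 * ε * X + drift (nbrs ω) x st.xhat (S₀ \ st.rest) (8 * ε * X) i)
    {i : Fin M} (hcol : ¬ Collision ar (nbrs ω) x st i ω.2)
    (hi : i ∉ leaves (nbrs ω) st.rest) : (leafTest ar ω μ i).val = none := by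
  have hE := drift_le_errBound h hp hs i
  have hres := (hs.res_le i).trans hE
  rw [val_leafTest, hI]
  rcases Nat.lt_or_ge (st.rest.filter (i ∈ nbrs ω ·)).card 2 with hlt | hge
  · have h0 : st.rest.filter (i ∈ nbrs ω ·) = ∅ := by
      have : (st.rest.filter (i ∈ nbrs ω ·)).card ≠ 1 := by
        intro h1; exact hi (by simp [leaves, h1])
      rw [← Finset.card_eq_zero]
      omega
    have : contrib (nbrs ω) x st.rest coefI i = 0 := by rw [contrib, h0, Finset.sum_empty]
    rw [this, sub_zero] at hres
    rw [h.candidate_eq_none i hres]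
  · rcases hcand : candidate ar (nbrs ω) (st.resI i) i with _ | j₀
    · rfl
    · dsimp only
      rw [if_neg]
      intro hd
      apply hcol
      refine ⟨hge, j₀, hcand, ?_⟩
      have hc := norm_contrib_le h hp st.rest norm_coefI i
      have hn : ‖st.resI i‖ ≤ 2 * n * X := by
        have := norm_le_norm_add_norm_sub' (st.resI i) (contrib (nbrs ω) x st.rest coefI i)
        nlinarith [h.errBound_le_one, h.X_mul_le, h.one_le_X]
      exact h.norm_le_of_discrepancy_le (norm_coefV ω i j₀) (h.abs_entry_le j₀ hn)
        ((hV i).trans hE) (norm_contrib_le h hp st.rest (fun j => norm_coefV ω i j) i) hd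

theorem isSome_leafTest_iff (h : Regime ar n k B ε X η) (hp : Peelable (nbrs ω) k x X η S₀)
    {st : PeelState n M} (hs : st.Sound (nbrs ω) x S₀ (8 * ε * X)) {μ : Memory n M}
    (hI : μ.resI = st.resI)
    (hV : ∀ i, ‖μ.resV i - contrib (nbrs ω) x st.rest (coefV ω i) i‖ ≤
      8 * ε * X + drift (nbrs ω) x st.xhat (S₀ \ st.rest) (8 * ε * X) i)
    (hcol : ∀ i, ¬ Collision ar (nbrs ω) x st i ω.2) (i : Fin M) :
    i ∈ leaves (nbrs ω) st.rest ↔ (leafTest ar ω μ i).val.isSome := by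
  constructor
  · intro hi
    obtain ⟨j, -, -, -, hcand, -⟩ := exists_parent h hp hs hi
    rw [leafTest_eq_some h hp hs hI hV hi hcand]
    rfl
  · intro hsome
    by_contra hi
    rw [leafTest_eq_none h hp hs hI hV (hcol i) hi] at hsome
    simp at hsome

/-- Decoding the parent `j` of the leaf `i` changes the status only of `i` and of the other
neighbours of `j`. -/
theorem leaves_erase_eq {N : Fin n → Finset (Fin M)} {R : Finset (Fin n)} {i : Fin M} {j : Fin n}
    (hfil : R.filter (i ∈ N ·) = {j}) (hij : i ∈ N j) {l : List (Fin M)}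
    (hl : ∀ a, a ∈ l ↔ a ∈ N j ∧ a ≠ i) :
    ((leaves N R).erase i).filter (· ∉ l) ∪ (leaves N (R.erase j)).filter (· ∈ l)
      = leaves N (R.erase j) := by
  ext a
  simp only [Finset.mem_union, Finset.mem_filter, Finset.mem_erase, hl]
  by_cases hai : a = i
  · subst hai
    -- The picked node is not tested again; erasing it is correct because its only remaining
    -- neighbour is gone.
    have : a ∉ leaves N (R.erase j) := by
      simp [leaves, Finset.filter_erase, hfil]
    simp [this]
  · by_cases haj : a ∈ N j
    · simp [hai, haj]
    · have : a ∈ leaves N R ↔ a ∈ leaves N (R.erase j) := by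
        simp only [leaves, Finset.mem_filter, Finset.mem_univ, true_and]
        rw [Finset.filter_erase, Finset.erase_eq_of_notMem (by simp [haj])]
      simp [hai, haj, this]

/-- Without collisions the decoder follows the run that knows the leaves. -/
theorem xhat_peel_eq (h : Regime ar n k B ε X η) (hp : Peelable (nbrs ω) k x X η S₀)
    {pick : ℕ → Finset (Fin M) → Fin M} (hpick : ∀ t L, L.Nonempty → pick t L ∈ L)
    {st₀ : PeelState n M} (hs₀ : st₀.Sound (nbrs ω) x S₀ (8 * ε * X)) {T : ℕ}
    (hcol : ∀ t ≤ T, ∀ i, ¬ Collision ar (nbrs ω) x (st₀.run ar (nbrs ω) pick t) i ω.2)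
    (f t : ℕ) (htf : t + f ≤ T) (μ : Memory n M)
    (hI : μ.resI = (st₀.run ar (nbrs ω) pick t).resI)
    (hx : μ.xhat = (st₀.run ar (nbrs ω) pick t).xhat)
    (hl : μ.leaf = leaves (nbrs ω) (st₀.run ar (nbrs ω) pick t).rest)
    (hV : ∀ i, ‖μ.resV i - contrib (nbrs ω) x (st₀.run ar (nbrs ω) pick t).rest (coefV ω i) i‖ ≤
      8 * ε * X + drift (nbrs ω) x (st₀.run ar (nbrs ω) pick t).xhat
        (S₀ \ (st₀.run ar (nbrs ω) pick t).rest) (8 * ε * X) i) :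
    (peel ar ω pick f t μ).val.xhat = (st₀.run ar (nbrs ω) pick (t + f)).xhat := by
  induction f generalizing t μ with
  | zero => exact hx
  | succ f ih =>
    have hs := (PeelState.sound_run h hp hs₀ hpick t).1
    have hs1 := (PeelState.sound_run h hp hs₀ hpick (t + 1)).1
    rw [val_peel_succ]
    by_cases hempty : μ.leaf = ∅
    · rw [if_pos hempty, hx, PeelState.run_eq_of_leaves_eq_empty st₀ (hl ▸ hempty)]
    · rw [if_neg hempty, hl]
      rw [hl] at hempty
      have hi := hpick t _ (Finset.nonempty_iff_ne_empty.2 hempty)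
      obtain ⟨j, hj, hij, hfil, hcand, hent⟩ := exists_parent h hp hs hi
      rw [leafTest_eq_some h hp hs hI hV hi hcand]
      have hnext : st₀.run ar (nbrs ω) pick (t + 1) =
          (st₀.run ar (nbrs ω) pick t).next ar (nbrs ω) pick t := rfl
      set st := st₀.run ar (nbrs ω) pick t with hst
      unfold PeelState.next at hnext
      rw [if_neg hempty] at hnext
      set i := pick t (leaves (nbrs ω) st.rest) with hidef
      simp only [hcand] at hnext
      dsimp only
      rw [foldl_subtract _ _ _ _ _ (nodup_nbrList ω j)]
      set v := entry ar (st.resI i) j with hv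
      have hjD : j ∉ S₀ \ st.rest := by simp [hj]
      have hjS := hs.rest_subset hj
      have hD : S₀ \ st.rest.erase j = insert j (S₀ \ st.rest) := by
        ext a
        simp only [Finset.mem_sdiff, Finset.mem_erase, Finset.mem_insert]
        by_cases ha : a = j
        · subst ha; simp [hjS]
        · simp [ha]
      have hE := fun i => drift_le_errBound h hp hs i
      have hI' : (fun a => if a ∈ nbrList ω j then reduce ar (coefI j) v (μ.resI a)
          else μ.resI a) = (st₀.run ar (nbrs ω) pick (t + 1)).resI := by
        rw [hnext]
        funext a
        simp only [mem_nbrList, hI]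
      have hV' : ∀ a, ‖(if a ∈ nbrList ω j then reduce ar (coefV ω a j) v (μ.resV a)
          else μ.resV a) - contrib (nbrs ω) x (st₀.run ar (nbrs ω) pick (t + 1)).rest
            (coefV ω a) a‖ ≤
          8 * ε * X + drift (nbrs ω) x (st₀.run ar (nbrs ω) pick (t + 1)).xhat
            (S₀ \ (st₀.run ar (nbrs ω) pick (t + 1)).rest) (8 * ε * X) a := by
        intro a
        rw [hnext]
        simp only [mem_nbrList]
        rw [hD]
        refine norm_sub_contrib_erase_le h hp (norm_coefV ω a) hj hjD (hV a)
          ((hE a).trans (h.errBound_le_one.trans (by norm_num))) (hent.trans ?_)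
        linarith [hE i, h.errBound_le_one, h.le_errBound]
      have hl' : ∀ a, a ∈ (nbrList ω j).erase i ↔ a ∈ nbrs ω j ∧ a ≠ i := by
        intro a
        rw [(nodup_nbrList ω j).mem_erase_iff, mem_nbrList]
        tauto
      rw [foldl_refresh ar ω (leaves (nbrs ω) (st₀.run ar (nbrs ω) pick (t + 1)).rest)]
      · rw [show t + (f + 1) = t + 1 + f by omega]
        apply ih (t + 1) (by omega)
        · exact hI'
        · rw [hnext]
          simp only [hx]
        · have := leaves_erase_eq hfil hij hl'
          rw [hnext]
          exact this
        · exact hV'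
      -- The list is refreshed even after the last iteration, so collisions have to be excluded at
      -- the final state as well.
      · exact isSome_leafTest_iff h hp hs1 hI' hV' (hcol (t + 1) (by omega))

/-- If the graph is peelable and there are no collisions, the output is accurate. -/
theorem abs_decode_sub_le (h : Regime ar n k B ε X η) (hp : Peelable (nbrs ω) k x X η S₀)
    {pick : ℕ → Finset (Fin M) → Fin M} (hpick : ∀ t L, L.Nonempty → pick t L ∈ L)
    (hcol : ∀ t ≤ k, ∀ i, ¬ Collision ar (nbrs ω) x
      ((PeelState.init ar (nbrs ω) x S₀).run ar (nbrs ω) pick t) i ω.2)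
    {y : Fin M × Fin 2 → ℂ} (hy0 : ∀ i, y (i, 0) = contrib (nbrs ω) x S₀ coefI i)
    (hy1 : ∀ i, y (i, 1) = contrib (nbrs ω) x S₀ (coefV ω i) i) (j : Fin n) :
    |(decode ar ω pick k y).val j - x j| ≤ errBound k ε X ∧
      (x j = 0 → (decode ar ω pick k y).val j = 0) := by
  have hs₀ := PeelState.sound_init h hp
  set st₀ := PeelState.init ar (nbrs ω) x S₀ with hst₀
  have hV : ∀ i, ‖ar.rndC (y (i, 1)) - contrib (nbrs ω) x st₀.rest (coefV ω i) i‖ ≤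
      8 * ε * X + drift (nbrs ω) x st₀.xhat (S₀ \ st₀.rest) (8 * ε * X) i := by
    intro i
    rw [hy1]
    have h1 := h.norm_rndC_sub_le (z := contrib (nbrs ω) x S₀ (coefV ω i) i)
      ((norm_contrib_le h hp S₀ (norm_coefV ω i) i).trans
        (by nlinarith [h.n_mul_le, h.two_le_cast]))
    have h2 : drift (nbrs ω) x st₀.xhat (S₀ \ st₀.rest) (8 * ε * X) i = 0 := by
      simp [hst₀, PeelState.init, drift]
    rw [h2]
    simp only [hst₀, PeelState.init]
    linarith [h.eps_mul_le, h.eps_nonneg]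
  have hI : (fun i => ar.rndC (y (i, 0))) = st₀.resI := by
    funext i; rw [hy0]; rfl
  rw [val_decode ar ω pick k y (leaves (nbrs ω) st₀.rest)
      (isSome_leafTest_iff h hp hs₀ hI hV (hcol 0 (Nat.zero_le _))),
    xhat_peel_eq h hp hpick hs₀ hcol k 0 (by omega) _ hI rfl rfl hV, Nat.zero_add]
  obtain ⟨hs, hcard⟩ := PeelState.sound_run h hp hs₀ hpick k
  refine abs_xhat_sub_le h hp hs ?_ j
  rw [← Finset.card_eq_zero]
  have h1 : st₀.rest.card ≤ k := hp.card_le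
  omega

end Coupling

/-! ### The probability of failure -/

section Probability

open Classical in
/-- The phases lead to some collision with probability at most `(k + 1) M / 2 ^ B`. -/
theorem card_exists_collision_mul_le {ar : Arith} {ε X η : ℝ} {x : Fin n → ℝ}
    {S₀ : Finset (Fin n)} {N : Fin n → Finset (Fin M)} (h : Regime ar n k B ε X η)
    (hp : Peelable N k x X η S₀) {st : ℕ → PeelState n M} (hst : ∀ t, (st t).rest ⊆ S₀) :
    (Finset.univ.filter fun θ : Fin M → Fin n → Fin (2 ^ B) =>
      ∃ t ≤ k, ∃ i, Collision ar N x (st t) i θ).card * 2 ^ B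
      ≤ (k + 1) * M * Fintype.card (Fin M → Fin n → Fin (2 ^ B)) := by
  have hsub : (Finset.univ.filter fun θ : Fin M → Fin n → Fin (2 ^ B) =>
      ∃ t ≤ k, ∃ i, Collision ar N x (st t) i θ) ⊆
      (Finset.range (k + 1) ×ˢ (Finset.univ : Finset (Fin M))).biUnion fun p =>
        Finset.univ.filter fun θ => Collision ar N x (st p.1) p.2 θ := by
    intro θ hθ
    obtain ⟨t, ht, i, hc⟩ := (Finset.mem_filter.1 hθ).2
    simp only [Finset.mem_biUnion, Finset.mem_product, Finset.mem_range, Finset.mem_univ, and_true,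
      Finset.mem_filter, true_and]
    exact ⟨(t, i), by simpa using Nat.lt_succ_of_le ht, hc⟩
  have hone : ∀ p : ℕ × Fin M, (Finset.univ.filter fun θ : Fin M → Fin n → Fin (2 ^ B) =>
      Collision ar N x (st p.1) p.2 θ).card * 2 ^ B
      ≤ Fintype.card (Fin M → Fin n → Fin (2 ^ B)) := by
    rintro ⟨t, i⟩
    by_cases h2 : 2 ≤ ((st t).rest.filter (i ∈ N ·)).card
    · rcases hc : candidate ar N ((st t).resI i) i with _ | j₀
      · have : (Finset.univ.filter fun θ : Fin M → Fin n → Fin (2 ^ B) =>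
            Collision ar N x (st t) i θ) = ∅ := by
          apply Finset.filter_false_of_mem
          rintro θ - ⟨-, j₀, hj₀, -⟩
          rw [hc] at hj₀
          simp at hj₀
        simp [this]
      · refine le_trans (Nat.mul_le_mul_right _ (Finset.card_le_card ?_))
          (card_collision_mul_le h.eta_pos h.tol_le ((st t).rest.filter (i ∈ N ·)) h2 x
            (fun j hj => hp.eta_le j (hst t (Finset.mem_filter.1 hj).1)) i j₀
            (entry ar ((st t).resI i) j₀))
        intro θ hθ
        obtain ⟨-, j₁, hj₁, hle⟩ := (Finset.mem_filter.1 hθ).2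
        rw [hc] at hj₁
        obtain rfl := Option.some_injective _ hj₁
        exact Finset.mem_filter.2 ⟨Finset.mem_univ _, hle⟩
    · have : (Finset.univ.filter fun θ : Fin M → Fin n → Fin (2 ^ B) =>
            Collision ar N x (st t) i θ) = ∅ := by
        apply Finset.filter_false_of_mem
        rintro θ - ⟨h3, -⟩
        exact h2 h3
      simp [this]
  calc _ ≤ (∑ p ∈ Finset.range (k + 1) ×ˢ (Finset.univ : Finset (Fin M)),
        (Finset.univ.filter fun θ : Fin M → Fin n → Fin (2 ^ B) =>
          Collision ar N x (st p.1) p.2 θ).card) * 2 ^ B :=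
        Nat.mul_le_mul_right _ ((Finset.card_le_card hsub).trans Finset.card_biUnion_le)
    _ ≤ ∑ p ∈ Finset.range (k + 1) ×ˢ (Finset.univ : Finset (Fin M)),
        Fintype.card (Fin M → Fin n → Fin (2 ^ B)) := by
        rw [Finset.sum_mul]
        exact Finset.sum_le_sum fun p _ => hone p
    _ = _ := by
        rw [Finset.sum_const, Finset.card_product, Finset.card_range, Finset.card_univ,
          Fintype.card_fin, smul_eq_mul]

/-- If failure has probability at most `q₁` in the first factor, and else at most `q₂` in the
second, success has probability at least `1 - (q₁ + q₂)`. -/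
theorem le_prob_prod {α β : Type} [Fintype α] [Fintype β] [Nonempty α] [Nonempty β]
    (E : Set (α × β)) (A : Finset α) (C : α → Finset β) {q₁ q₂ : ℝ} (hq₂ : 0 ≤ q₂)
    (hA : (A.card : ℝ) ≤ q₁ * Fintype.card α)
    (hC : ∀ a ∉ A, ((C a).card : ℝ) ≤ q₂ * Fintype.card β)
    (hE : ∀ a ∉ A, ∀ b ∉ C a, (a, b) ∈ E) : 1 - (q₁ + q₂) ≤ prob E := by
  classical
  have hα : (0 : ℝ) < Fintype.card α := by exact_mod_cast Fintype.card_pos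
  have hβ : (0 : ℝ) < Fintype.card β := by exact_mod_cast Fintype.card_pos
  have h1 : (E.ncard : ℝ) + (Eᶜ.ncard : ℝ) = Fintype.card α * Fintype.card β := by
    have := Set.ncard_add_ncard_compl E
    rw [Nat.card_eq_fintype_card, Fintype.card_prod] at this
    exact_mod_cast this
  have h2 : (Eᶜ.ncard : ℝ) ≤ (q₁ + q₂) * (Fintype.card α * Fintype.card β) := by
    have hsub : Eᶜ ⊆ ((A ×ˢ (Finset.univ : Finset β) ∪
        (Finset.univ \ A).biUnion fun a => {a} ×ˢ C a : Finset (α × β)) : Set (α × β)) := by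
      rintro ⟨a, b⟩ hab
      by_cases ha : a ∈ A
      · simp [ha]
      · have : b ∈ C a := by
          by_contra hb
          exact hab (hE a ha b hb)
        simp [ha, this]
    have h3 := Set.ncard_le_ncard hsub (Finset.finite_toSet _)
    rw [Set.ncard_coe_finset] at h3
    have h4 : ((Eᶜ.ncard : ℕ) : ℝ) ≤ (A.card : ℝ) * Fintype.card β +
        ∑ a ∈ Finset.univ \ A, ((C a).card : ℝ) := by
      have := h3.trans ((Finset.card_union_le _ _).trans
        (Nat.add_le_add_left Finset.card_biUnion_le _))
      simp only [Finset.card_product, Finset.card_univ, Finset.card_singleton, one_mul] at this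
      exact_mod_cast this
    have h5 : ∑ a ∈ Finset.univ \ A, ((C a).card : ℝ) ≤
        Fintype.card α * (q₂ * Fintype.card β) := by
      calc _ ≤ ∑ a ∈ Finset.univ \ A, q₂ * Fintype.card β := Finset.sum_le_sum fun a ha =>
            hC a (Finset.mem_sdiff.1 ha).2
        _ ≤ ∑ a : α, q₂ * Fintype.card β := Finset.sum_le_sum_of_subset_of_nonneg
            Finset.sdiff_subset fun _ _ _ => by positivity
        _ = _ := by rw [Finset.sum_const, Finset.card_univ, nsmul_eq_mul]
    have h6 := mul_le_mul_of_nonneg_right hA hβ.le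
    linarith
  unfold prob
  rw [le_div_iff₀ (by exact_mod_cast Fintype.card_pos), Fintype.card_prod]
  push_cast
  linarith

/-- With probability at least `1 - O(1 / k)` the output of the decoder is accurate. -/
theorem le_prob_decode {c : ℕ} (hd : 7 ≤ d) (hc : 100 * d ^ 2 ≤ c) {ar : Arith} {ε X η : ℝ}
    (h : Regime ar n k (3 * Nat.clog 2 k) ε X η) {x : Fin n → ℝ} (hx : Sparse k x)
    (hη : ∀ j, x j ≠ 0 → η ≤ |x j|) (hX : ∀ j, |x j| ≤ X)
    {pick : ℕ → Finset (Fin (c * k)) → Fin (c * k)} (hpick : ∀ t L, L.Nonempty → pick t L ∈ L) :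
    1 - (2 + 2 * c : ℝ) / k ≤ prob {ω : Design n (c * k) d (3 * Nat.clog 2 k) |
      ∀ j, |(decode ar ω pick k (measure ω x)).val j - x j| ≤ errBound k ε X ∧
        (x j = 0 → (decode ar ω pick k (measure ω x)).val j = 0)} := by
  classical
  have hk := h.one_le_k
  have hk' : (0 : ℝ) < k := by exact_mod_cast hk
  have hdM : d ≤ c * k := by nlinarith
  have hne : Nonempty {s : Finset (Fin (c * k)) // s.card = d} := by
    rw [← Fintype.card_pos_iff, card_subsets]
    exact Nat.choose_pos hdM
  set S₀ : Finset (Fin n) := Finset.univ.filter fun j => x j ≠ 0 with hS₀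
  have hS₀k : S₀.card ≤ k := by
    have : ((S₀ : Finset (Fin n)) : Set (Fin n)) = {j | x j ≠ 0} := by ext; simp [hS₀]
    rw [← Set.ncard_coe_finset, this]
    exact hx
  have hcontrib : ∀ (N : Fin n → Finset (Fin (c * k))) (a : Fin n → ℂ) (i : Fin (c * k)),
      ∑ j, (if i ∈ N j then a j else 0) * (x j : ℂ) = contrib N x S₀ a i := by
    intro N a i
    rw [contrib, hS₀, Finset.filter_filter, Finset.sum_filter]
    refine Finset.sum_congr rfl fun j _ => ?_
    by_cases hxj : x j = 0
    · simp [hxj]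
    · by_cases hij : i ∈ N j
      · simp [hxj, hij, mul_comm]
      · simp [hij]
  let A : Finset (Fin n → {s : Finset (Fin (c * k)) // s.card = d}) :=
    (Finset.univ.filter fun g => Leafless (fun j => (g j).1) S₀) ∪
      Finset.univ.filter fun g => ManyWalks (fun j => (g j).1) k S₀
  -- For a fixed graph this sequence of states is deterministic, so the phases are still uniform
  -- when the collisions along it are counted.
  let run : (Fin n → {s : Finset (Fin (c * k)) // s.card = d}) → ℕ → PeelState n (c * k) :=
    fun g => (PeelState.init ar (fun j => (g j).1) x S₀).run ar (fun j => (g j).1) pick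
  let C : (Fin n → {s : Finset (Fin (c * k)) // s.card = d}) →
      Finset (Fin (c * k) → Fin n → Fin (2 ^ (3 * Nat.clog 2 k))) := fun g =>
    Finset.univ.filter fun θ => ∃ t ≤ k, ∃ i, Collision ar (fun j => (g j).1) x (run g t) i θ
  have hgood : ∀ g ∉ A, Peelable (fun j => (g j).1) k x X η S₀ := by
    intro g hg
    simp only [A, Finset.mem_union, Finset.mem_filter, Finset.mem_univ, true_and, not_or] at hg
    exact ⟨fun j => by simp [hS₀], hS₀k, fun j hj => hη j (by simpa [hS₀] using hj), hX, hg.2, hg.1⟩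
  have hA : (A.card : ℝ) ≤ (2 / k) *
      Fintype.card (Fin n → {s : Finset (Fin (c * k)) // s.card = d}) := by
    have h1 := card_leafless_le hd hc hk S₀ hS₀k
    have h2 := card_manyWalks_le (M := c * k) (d := d) (by omega)
      (Nat.mul_le_mul_right k (by nlinarith)) hk S₀ hS₀k
    refine ((Nat.cast_le (α := ℝ)).2 (Finset.card_union_le _ _)).trans ?_
    push_cast
    refine (add_le_add h1 h2).trans (le_of_eq ?_)
    ring
  have hC : ∀ g ∉ A, ((C g).card : ℝ) ≤ (2 * c / k) *
      Fintype.card (Fin (c * k) → Fin n → Fin (2 ^ (3 * Nat.clog 2 k))) := by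
    intro g hg
    have hp := hgood g hg
    have h1 := card_exists_collision_mul_le h hp (st := run g) fun t =>
      (PeelState.sound_run h hp (PeelState.sound_init h hp) hpick t).1.rest_subset
    -- The reason for `3 ⌈log₂ k⌉` bits per phase: `(k + 1) c k` possible collisions of probability
    -- `k ^ (-3)` leave `2 c / k`.
    have h2 : k ^ 3 ≤ 2 ^ (3 * Nat.clog 2 k) := by
      rw [Nat.mul_comm, pow_mul]
      exact Nat.pow_le_pow_left (Nat.le_pow_clog one_lt_two k) 3
    have h3 : (C g).card * k ^ 3 ≤ 2 * c * k ^ 2 *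
        Fintype.card (Fin (c * k) → Fin n → Fin (2 ^ (3 * Nat.clog 2 k))) := by
      refine (Nat.mul_le_mul_left _ h2).trans (h1.trans (Nat.mul_le_mul_right _ ?_))
      calc (k + 1) * (c * k) ≤ (2 * k) * (c * k) := Nat.mul_le_mul_right _ (by omega)
        _ = _ := by ring
    have h4 : ((C g).card : ℝ) * k ^ 3 ≤ 2 * c * k ^ 2 *
        Fintype.card (Fin (c * k) → Fin n → Fin (2 ^ (3 * Nat.clog 2 k))) := by exact_mod_cast h3
    rw [div_mul_eq_mul_div, le_div_iff₀ hk']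
    have : (0 : ℝ) < (k : ℝ) ^ 2 := by positivity
    refine le_of_mul_le_mul_right ?_ this
    linarith
  have hmain := le_prob_prod {ω : Design n (c * k) d (3 * Nat.clog 2 k) |
      ∀ j, |(decode ar ω pick k (measure ω x)).val j - x j| ≤ errBound k ε X ∧
        (x j = 0 → (decode ar ω pick k (measure ω x)).val j = 0)} A C
      (by positivity) hA hC ?_
  · refine le_trans (le_of_eq ?_) hmain
    ring
  · intro g hg θ hθ j
    have hp := hgood g hg
    refine abs_decode_sub_le (ω := (g, θ)) h hp hpick ?_ ?_ ?_ j
    · intro t ht i hcol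
      exact hθ (Finset.mem_filter.2 ⟨Finset.mem_univ _, t, ht, i, hcol⟩)
    · intro i
      rw [← hcontrib]
      simp [measure, Matrix.mulVec, dotProduct, sensing]
    · intro i
      rw [← hcontrib]
      simp [measure, Matrix.mulVec, dotProduct, sensing]

end Probability

end SHOFA

/-! ### Exact arithmetic, fixed-point arithmetic and representations -/

namespace SHOFA

open Real

variable {n M d B k : ℕ}

theorem prob_mono {Ω : Type} [Fintype Ω] {E F : Set Ω} (h : E ⊆ F) : prob E ≤ prob F := by
  unfold prob
  refine div_le_div_of_nonneg_right ?_ (Nat.cast_nonneg _)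
  exact_mod_cast Set.ncard_le_ncard h (Set.toFinite _)

/-- Saturation moves a rounded value towards the interval that contains `r`, so it cannot increase
the error. -/
theorem abs_fix_sub_le (s : ℕ) {r : ℝ} (hr : |r| ≤ 2 ^ s) : |fix s r - r| ≤ (2 ^ s)⁻¹ := by
  have h2 : (0 : ℝ) < 2 ^ s := by positivity
  have h1 : |(round (r * 2 ^ s) : ℝ) / 2 ^ s - r| ≤ (2 ^ s)⁻¹ := by
    have e : (round (r * 2 ^ s) : ℝ) / 2 ^ s - r = -(r * 2 ^ s - round (r * 2 ^ s)) * (2 ^ s)⁻¹ := by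
      field_simp; ring
    rw [e, abs_mul, abs_neg, abs_of_pos (inv_pos.2 h2)]
    have := abs_sub_round (r * 2 ^ s)
    have h3 : 0 < ((2 : ℝ) ^ s)⁻¹ := inv_pos.2 h2
    nlinarith
  have h3 : 0 < ((2 : ℝ) ^ s)⁻¹ := inv_pos.2 h2
  unfold fix
  rw [abs_le] at h1 hr ⊢
  constructor
  · have := le_max_right (-(2 : ℝ) ^ s) (min (2 ^ s) ((round (r * 2 ^ s) : ℝ) / 2 ^ s))
    have : r - (2 ^ s)⁻¹ ≤ min (2 ^ s) ((round (r * 2 ^ s) : ℝ) / 2 ^ s) :=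
      le_min (by linarith [hr.2]) (by linarith [h1.1])
    linarith
  · have : max (-(2 : ℝ) ^ s) (min (2 ^ s) ((round (r * 2 ^ s) : ℝ) / 2 ^ s)) ≤ r + (2 ^ s)⁻¹ :=
      max_le (by linarith [hr.1]) ((min_le_right _ _).trans (by linarith [h1.2]))
    linarith

theorem exists_eta (x : Fin n → ℝ) : ∃ η : ℝ, 0 < η ∧ η ≤ 1 ∧ ∀ j, x j ≠ 0 → η ≤ |x j| := by
  classical
  rcases (Finset.univ.filter fun j => x j ≠ 0).eq_empty_or_nonempty with h | h
  · refine ⟨1, one_pos, le_rfl, fun j hj => ?_⟩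
    have : j ∈ Finset.univ.filter fun j => x j ≠ 0 := Finset.mem_filter.2 ⟨Finset.mem_univ j, hj⟩
    rw [h] at this
    simp at this
  · obtain ⟨j₀, hj₀, hmin⟩ := Finset.exists_min_image _ (fun j => |x j|) h
    refine ⟨min 1 |x j₀|, lt_min one_pos (abs_pos.2 (Finset.mem_filter.1 hj₀).2), min_le_left _ _,
      fun j hj => (min_le_right _ _).trans (hmin j (Finset.mem_filter.2 ⟨Finset.mem_univ j, hj⟩))⟩

/-- With `ε = 0` the error bound vanishes and tolerance zero is admissible for all `X` and `η`,
which may therefore depend on the signal. -/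
theorem regime_exact (hn : 2 ≤ n) (hk : 1 ≤ k) (hkn : k ≤ n) {X η : ℝ} (hX : 1 ≤ X) (hη : 0 < η)
    (hη1 : η ≤ 1) : Regime exact n k B 0 X η where
  two_le := hn
  one_le_k := hk
  k_le := hkn
  eps_nonneg := le_rfl
  acc r _ := by simp [exact]
  one_le_X := hX
  eta_pos := hη
  eta_le := hη1
  err_le := by simp [errBound, exact]
  tol_le := by simp [exact, hη.le]

theorem le_prob_decode_exact {c : ℕ} (hd : 7 ≤ d) (hc : 100 * d ^ 2 ≤ c) (hn : 2 ≤ n) (hk : 1 ≤ k)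
    (hkn : k ≤ n) {pick : ℕ → Finset (Fin (c * k)) → Fin (c * k)}
    (hpick : ∀ t L, L.Nonempty → pick t L ∈ L) {x : Fin n → ℝ} (hx : Sparse k x) :
    1 - (2 + 2 * c : ℝ) / k ≤ prob {ω : Design n (c * k) d (3 * Nat.clog 2 k) |
      (decode exact ω pick k (measure ω x)).val = x} := by
  obtain ⟨η, hη, hη1, hηx⟩ := exists_eta x
  have hl1 : ∀ j, |x j| ≤ l1 x := fun j =>
    Finset.single_le_sum (f := fun j => |x j|) (fun j _ => abs_nonneg _) (Finset.mem_univ j)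
  have h0 : 0 ≤ l1 x := Finset.sum_nonneg fun j _ => abs_nonneg _
  refine (le_prob_decode hd hc (regime_exact hn hk hkn (X := 1 + l1 x) (by linarith) hη hη1) hx
    hηx (fun j => (hl1 j).trans (by linarith)) hpick).trans (prob_mono fun ω hω => ?_)
  funext j
  have := (hω j).1
  rw [errBound, mul_zero, zero_mul, zero_mul] at this
  exact sub_eq_zero.1 (abs_nonpos_iff.1 this)

theorem le_two_pow_precision (n P : ℕ) : n ≤ 2 ^ (Nat.clog 2 n + P) :=
  (Nat.le_pow_clog one_lt_two n).trans (Nat.pow_le_pow_right two_pos (Nat.le_add_right _ _))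

theorem one_le_precision (hn : 2 ≤ n) (P : ℕ) : 1 ≤ Nat.clog 2 n + P :=
  (Nat.succ_le_of_lt (Nat.clog_pos one_lt_two hn)).trans (Nat.le_add_right _ _)

/-- Everything is compared with powers of `z = 2 ^ p`, which dominates `n`, `k` and `2`. With `η = z
^ (-κ)`, the phase resolution costs at most `16 * 2 ^ B ≤ z ^ 7`, whence the tolerance `z ^ (-(κ +
7))`. The amplification of errors costs at most `z ^ 20`, so `ε = z ^ (-(2 κ + 27))` is small
enough. -/
theorem regime_fixedPoint (hn : 2 ≤ n) (hk : 1 ≤ k) (hkn : k ≤ n) (κ P : ℕ) :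
    Regime (fixedPoint ((2 * κ + 27) * (Nat.clog 2 n + P)) ((κ + 7) * (Nat.clog 2 n + P)))
      n k (3 * Nat.clog 2 k) ((2 ^ ((2 * κ + 27) * (Nat.clog 2 n + P)))⁻¹) 1
      ((2 ^ (κ * (Nat.clog 2 n + P)))⁻¹) := by
  set p := Nat.clog 2 n + P with hp
  have hp1 : 1 ≤ p := one_le_precision hn P
  set z : ℝ := 2 ^ p with hz
  have hz2 : 2 ≤ z := by
    rw [hz]; exact le_self_pow₀ (by norm_num) (by omega)
  have hz1 : 1 ≤ z := by linarith
  have hz0 : 0 < z := by linarith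
  have hnz : (n : ℝ) ≤ z := by
    rw [hz]; exact_mod_cast le_two_pow_precision n P
  have hkz : (k : ℝ) ≤ z := le_trans (by exact_mod_cast hkn) hnz
  have hpow : ∀ a : ℕ, (2 : ℝ) ^ (a * p) = z ^ a := fun a => by rw [hz, ← pow_mul, mul_comm]
  have htwo : ∀ a : ℕ, (2 : ℝ) ^ a ≤ z ^ a := fun a => pow_le_pow_left₀ (by norm_num) hz2 a
  have htol : (fixedPoint ((2 * κ + 27) * p) ((κ + 7) * p)).tol = (z ^ (κ + 7))⁻¹ := by
    simp only [fixedPoint]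
    rw [zpow_neg, zpow_natCast, hpow]
  have hk1 : (1 : ℝ) ≤ k := by exact_mod_cast hk
  refine ⟨hn, hk, hkn, by positivity, ?_, le_rfl, by positivity, ?_, ?_, ?_⟩
  · intro r hr
    refine abs_fix_sub_le _ (hr.trans ?_)
    rw [hpow, mul_one]
    calc 100 * (n : ℝ) ≤ z ^ 7 * z := mul_le_mul (le_trans (by norm_num) (htwo 7)) hnz
          (Nat.cast_nonneg _) (by positivity)
      _ = z ^ 8 := by ring
      _ ≤ _ := pow_le_pow_right₀ hz1 (by omega)
  · exact inv_le_one_of_one_le₀ (one_le_pow₀ (by norm_num))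
  · rw [htol, hpow, hpow, errBound, ← mul_inv, ← pow_add]
    have h1 : 1000 * (n : ℝ) * (8 * (1 + 8 * (k : ℝ) ^ 2)) ≤ z ^ 20 := by
      calc 1000 * (n : ℝ) * (8 * (1 + 8 * (k : ℝ) ^ 2))
          ≤ 1000 * z * (8 * (9 * z ^ 2)) := by
            have : (k : ℝ) ^ 2 ≤ z ^ 2 := pow_le_pow_left₀ (by linarith) hkz 2
            have : 1 ≤ z ^ 2 := one_le_pow₀ hz1
            exact mul_le_mul (by linarith) (by linarith) (by positivity) (by positivity)
        _ = 72000 * z ^ 3 := by ring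
        _ ≤ z ^ 17 * z ^ 3 := mul_le_mul_of_nonneg_right (le_trans (by norm_num) (htwo 17))
            (by positivity)
        _ = z ^ 20 := by ring
    have h2 : z ^ (2 * κ + 27) = z ^ 20 * z ^ (κ + 7 + κ) := by rw [← pow_add]; congr 1; omega
    rw [h2, mul_inv]
    calc 1000 * (n : ℝ) * (8 * ((z ^ 20)⁻¹ * (z ^ (κ + 7 + κ))⁻¹) * 1 * (1 + 8 * (k : ℝ) ^ 2))
        = (1000 * (n : ℝ) * (8 * (1 + 8 * (k : ℝ) ^ 2)) * (z ^ 20)⁻¹) * (z ^ (κ + 7 + κ))⁻¹ := by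
          ring
      _ ≤ 1 * (z ^ (κ + 7 + κ))⁻¹ := by
          refine mul_le_mul_of_nonneg_right ?_ (by positivity)
          rw [mul_inv_le_iff₀ (by positivity), one_mul]
          exact h1
      _ = _ := one_mul _
  · rw [htol, hpow]
    have h1 : (2 : ℝ) ^ (3 * Nat.clog 2 k) ≤ z ^ 3 := by
      rw [hz, ← pow_mul, mul_comm p 3]
      refine pow_le_pow_right₀ (by norm_num) (Nat.mul_le_mul_left 3 ?_)
      exact (Nat.clog_mono_right 2 hkn).trans (Nat.le_add_right _ _)
    calc 16 * (z ^ (κ + 7))⁻¹ * 2 ^ (3 * Nat.clog 2 k) ≤ z ^ 4 * (z ^ (κ + 7))⁻¹ * z ^ 3 := by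
          gcongr
          exact le_trans (by norm_num) (htwo 4)
      _ = _ := by
          rw [pow_add]
          field_simp

theorem smul_measure (ω : Design n M d B) (x : Fin n → ℝ) (e : ℤ) :
    (2 : ℂ) ^ e • measure ω x = measure ω (fun j => (2 : ℝ) ^ e * x j) := by
  unfold measure
  rw [← Matrix.mulVec_smul]
  congr 1
  funext j
  simp

theorem l1_add_le (x y : Fin n → ℝ) : l1 (x + y) ≤ l1 x + l1 y := by
  unfold l1
  rw [← Finset.sum_add_distrib]
  exact Finset.sum_le_sum fun j _ => abs_add_le _ _

theorem l1_nonneg (x : Fin n → ℝ) : 0 ≤ l1 x := Finset.sum_nonneg fun _ _ => abs_nonneg _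

theorem eq_zero_of_l1_nonpos {x : Fin n → ℝ} (hx : l1 x ≤ 0) : x = 0 := by
  have h := le_antisymm hx (l1_nonneg x)
  unfold l1 at h
  rw [Finset.sum_eq_zero_iff_of_nonneg fun _ _ => abs_nonneg _] at h
  funext j
  simpa using h j (Finset.mem_univ j)

theorem two_zpow_neg_succ_le (P : ℕ) : (2 : ℝ) ^ (-((P : ℤ) + 1)) ≤ 1 / 2 := by
  rw [neg_add, zpow_add₀ (by norm_num), zpow_neg, zpow_natCast, zpow_neg_one]
  have : ((2 : ℝ) ^ P)⁻¹ ≤ 1 := inv_le_one_of_one_le₀ (one_le_pow₀ (by norm_num))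
  linarith

/-- Scaling by `2 ^ (-e)` moves the nonzero entries of `x'` into `[η, 1]`, the range of the regime.
The relative error `2 ^ (-P)` is split evenly between the representation and the decoder. -/
theorem le_prob_decode_fixedPoint {c : ℕ} (hd : 7 ≤ d) (hc : 100 * d ^ 2 ≤ c) (hn : 2 ≤ n)
    (hk : 1 ≤ k) (hkn : k ≤ n) {pick : ℕ → Finset (Fin (c * k)) → Fin (c * k)}
    (hpick : ∀ t L, L.Nonempty → pick t L ∈ L) (κ P : ℕ) {x x' : Fin n → ℝ} {e : ℤ}
    (hx : Represents k P (κ * (Nat.clog 2 n + P)) e x x') :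
    1 - (2 + 2 * c : ℝ) / k ≤ prob {ω : Design n (c * k) d (3 * Nat.clog 2 k) |
      l1 (x - (2 : ℝ) ^ e • (decode (fixedPoint ((2 * κ + 27) * (Nat.clog 2 n + P))
        ((κ + 7) * (Nat.clog 2 n + P))) ω pick k ((2 : ℂ) ^ (-e) • measure ω x')).val)
        ≤ (2 : ℝ) ^ (-(P : ℤ)) * l1 x} := by
  obtain ⟨hsp, happ, hrange⟩ := hx
  have hreg := regime_fixedPoint (k := k) hn hk hkn κ P
  set ar := fixedPoint ((2 * κ + 27) * (Nat.clog 2 n + P)) ((κ + 7) * (Nat.clog 2 n + P)) with har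
  set η : ℝ := (2 ^ (κ * (Nat.clog 2 n + P)))⁻¹ with hη
  set E := errBound k (2 ^ ((2 * κ + 27) * (Nat.clog 2 n + P)))⁻¹ 1 with hE
  have h2e : (0 : ℝ) < 2 ^ e := by positivity
  have hee : (2 : ℝ) ^ (-e) * 2 ^ e = 1 := by rw [← zpow_add₀ (by norm_num)]; simp
  have hlow : ∀ j, x' j ≠ 0 → 2 ^ e * η ≤ |x' j| := by
    intro j hj
    have := (hrange j hj).1
    rwa [zpow_sub₀ (by norm_num), zpow_natCast, div_eq_mul_inv] at this
  set w : Fin n → ℝ := fun j => (2 : ℝ) ^ (-e) * x' j with hw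
  have habsw : ∀ j, |w j| = (2 : ℝ) ^ (-e) * |x' j| := fun j => by
    rw [hw, abs_mul, abs_of_pos (by positivity)]
  have hw0 : ∀ j, w j ≠ 0 → x' j ≠ 0 := by
    intro j hj h0
    exact hj (by simp [hw, h0])
  have hwsp : Sparse k w := by
    refine (Set.ncard_le_ncard ?_ (Set.toFinite _)).trans hsp
    exact fun j hj => hw0 j hj
  have hwη : ∀ j, w j ≠ 0 → η ≤ |w j| := by
    intro j hj
    rw [habsw]
    calc η = (2 : ℝ) ^ (-e) * (2 ^ e * η) := by rw [← mul_assoc, hee, one_mul]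
      _ ≤ _ := mul_le_mul_of_nonneg_left (hlow j (hw0 j hj)) (by positivity)
  have hwX : ∀ j, |w j| ≤ 1 := by
    intro j
    by_cases hj : x' j = 0
    · simp [hw, hj]
    · rw [habsw, ← hee]
      exact mul_le_mul_of_nonneg_left (hrange j hj).2 (by positivity)
  refine (le_prob_decode hd hc hreg hwsp hwη hwX hpick).trans (prob_mono fun ω hω => ?_)
  simp only [Set.mem_ofPred_eq] at hω ⊢
  rw [smul_measure]
  set xh := (decode ar ω pick k (measure ω w)).val with hxh
  have hx'w : ∀ j, x' j = 2 ^ e * w j := fun j => by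
    rw [hw]; dsimp only; rw [← mul_assoc, mul_comm ((2 : ℝ) ^ e), hee, one_mul]
  have hlx := l1_nonneg x
  -- If `x' = 0`, its relative accuracy of at least `1 / 2` forces `x = 0`. The output must then be
  -- exactly zero, which is why zero entries are known to be recovered exactly.
  by_cases hzero : x' = 0
  · have hxz : x = 0 := by
      apply eq_zero_of_l1_nonpos
      rw [hzero, sub_zero] at happ
      have := mul_le_mul_of_nonneg_right (two_zpow_neg_succ_le P) hlx
      linarith
    have hxhz : xh = 0 := by
      funext j
      exact (hω j).2 (by simp [hw, hzero])
    rw [hxz, hxhz]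
    simp [l1]
  · obtain ⟨j₀, hj₀⟩ : ∃ j, x' j ≠ 0 := by
      by_contra! hcon
      exact hzero (funext hcon)
    have hl1x' : 2 ^ e * η ≤ l1 x' := (hlow j₀ hj₀).trans
      (Finset.single_le_sum (f := fun j => |x' j|) (fun j _ => abs_nonneg _) (Finset.mem_univ j₀))
    have hl1le : l1 x' ≤ 2 * l1 x := by
      have h1 : l1 x' ≤ l1 x + l1 (x - x') := by
        have : l1 (x - x') = l1 (x' - x) := by
          unfold l1
          refine Finset.sum_congr rfl fun j _ => ?_
          simp only [Pi.sub_apply]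
          rw [abs_sub_comm]
        rw [this]
        refine le_trans (le_of_eq ?_) (l1_add_le x (x' - x))
        congr 1
        abel
      have := mul_le_mul_of_nonneg_right (two_zpow_neg_succ_le P) hlx
      linarith
    have hdiff : l1 (x' - (2 : ℝ) ^ e • xh) ≤ 2 ^ e * (n * E) := by
      unfold l1
      calc _ ≤ ∑ j : Fin n, 2 ^ e * E := by
            refine Finset.sum_le_sum fun j _ => ?_
            simp only [Pi.sub_apply, Pi.smul_apply, smul_eq_mul]
            rw [hx'w j, ← mul_sub, abs_mul, abs_of_pos h2e, abs_sub_comm]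
            exact mul_le_mul_of_nonneg_left (hω j).1 h2e.le
        _ = _ := by
            rw [Finset.sum_const, Finset.card_univ, Fintype.card_fin, nsmul_eq_mul]; ring
    have htol : ar.tol ≤ (2 : ℝ) ^ (-(P : ℤ)) := by
      rw [har]
      simp only [fixedPoint]
      refine zpow_le_zpow_right₀ (by norm_num) ?_
      have : P ≤ (κ + 7) * (Nat.clog 2 n + P) := by nlinarith [Nat.zero_le (Nat.clog 2 n)]
      exact_mod_cast neg_le_neg (by exact_mod_cast this)
    have herr := hreg.err_le
    have htri : l1 (x - (2 : ℝ) ^ e • xh) ≤ l1 (x - x') + l1 (x' - (2 : ℝ) ^ e • xh) := by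
      refine le_trans (le_of_eq ?_) (l1_add_le _ _)
      congr 1
      abel
    have hP : (2 : ℝ) ^ (-((P : ℤ) + 1)) = 2 ^ (-(P : ℤ)) / 2 := by
      rw [neg_add, zpow_add₀ (by norm_num), zpow_neg_one]; rfl
    rw [hP] at happ
    -- The factor `η` in `Regime.err_le` turns the absolute error into a relative one, since a
    -- single entry already gives `2 ^ e * η ≤ l1 x'`.
    have h1 : 2 ^ e * (1000 * n * E) ≤ ar.tol * (2 * l1 x) := by
      calc 2 ^ e * (1000 * n * E) ≤ 2 ^ e * (ar.tol * η) := mul_le_mul_of_nonneg_left herr h2e.le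
        _ = ar.tol * (2 ^ e * η) := by ring
        _ ≤ _ := mul_le_mul_of_nonneg_left (hl1x'.trans hl1le) hreg.tol_nonneg
    have h2 : ar.tol * (2 * l1 x) ≤ (2 : ℝ) ^ (-(P : ℤ)) * (2 * l1 x) :=
      mul_le_mul_of_nonneg_right htol (by linarith)
    have h3 : 0 ≤ (2 : ℝ) ^ (-(P : ℤ)) * l1 x := by positivity
    linarith

/-- Dropping the small entries gives a finite-precision representation. -/
theorem exists_represents (hn : 2 ≤ n) {κ : ℕ} (hκ : 3 ≤ κ) (P : ℕ) {x : Fin n → ℝ}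
    (hx : Sparse k x) :
    ∃ (x' : Fin n → ℝ) (e : ℤ), Represents k P (κ * (Nat.clog 2 n + P)) e x x' := by
  classical
  by_cases hzero : x = 0
  · refine ⟨0, 0, ?_, ?_, fun j hj => absurd rfl hj⟩
    · simp [Sparse]
    · rw [hzero]; simp [l1]
  · have hne : (Finset.univ : Finset (Fin n)).Nonempty := ⟨⟨0, by omega⟩, Finset.mem_univ _⟩
    obtain ⟨j₀, -, hmax⟩ := Finset.exists_max_image Finset.univ (fun j => |x j|) hne
    have hpos : 0 < |x j₀| := by
      rw [abs_pos]
      intro h0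
      apply hzero
      funext j
      have := hmax j (Finset.mem_univ j)
      rw [h0, abs_zero] at this
      exact abs_nonpos_iff.1 this
    -- The largest entry lies in `(2 ^ e, 2 ^ (e + 1)]`, so the common exponent is `e + 1`.
    obtain ⟨e, he1, he2⟩ := exists_mem_Ioc_zpow hpos (one_lt_two (α := ℝ))
    set p := Nat.clog 2 n + P with hp
    have hp1 : 1 ≤ p := one_le_precision hn P
    set b : ℝ := 2 ^ ((e + 1) - ((κ * p : ℕ) : ℤ)) with hb
    have hb0 : 0 < b := by positivity
    refine ⟨fun j => if b ≤ |x j| then x j else 0, e + 1, ?_, ?_, ?_⟩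
    · refine (Set.ncard_le_ncard ?_ (Set.toFinite _)).trans hx
      intro j hj
      simp only [Set.mem_ofPred_eq] at hj ⊢
      intro h0
      exact hj (by simp [h0])
    · have h1 : l1 (x - fun j => if b ≤ |x j| then x j else 0) ≤ n * b := by
        unfold l1
        calc _ ≤ ∑ j : Fin n, b := by
              refine Finset.sum_le_sum fun j _ => ?_
              simp only [Pi.sub_apply]
              split_ifs with hj
              · simp [hb0.le]
              · rw [sub_zero]; exact (not_le.1 hj).le
          _ = _ := by rw [Finset.sum_const, Finset.card_univ, Fintype.card_fin, nsmul_eq_mul]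
      have h2 : |x j₀| ≤ l1 x := Finset.single_le_sum (f := fun j => |x j|)
        (fun j _ => abs_nonneg _) (Finset.mem_univ j₀)
      have h3 : (n : ℝ) ≤ 2 ^ ((Nat.clog 2 n : ℕ) : ℤ) := by
        rw [zpow_natCast]; exact_mod_cast Nat.le_pow_clog one_lt_two n
      refine h1.trans ?_
      calc (n : ℝ) * b ≤ 2 ^ ((Nat.clog 2 n : ℕ) : ℤ) * b := mul_le_mul_of_nonneg_right h3 hb0.le
        _ = (2 : ℝ) ^ (((Nat.clog 2 n : ℕ) : ℤ) + ((e + 1) - ((κ * p : ℕ) : ℤ))) := by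
            rw [hb, ← zpow_add₀ (by norm_num)]
        -- Here `κ ≥ 3` is used: one `p` pays for `⌈log₂ n⌉ + P`, and the other two pay for the two
        -- units from `e + 1` and `P + 1`, as `p ≥ 1`.
        _ ≤ (2 : ℝ) ^ (-((P : ℤ) + 1) + e) := by
            refine zpow_le_zpow_right₀ (by norm_num) ?_
            have : 3 * p ≤ κ * p := Nat.mul_le_mul_right p hκ
            omega
        _ = 2 ^ (-((P : ℤ) + 1)) * 2 ^ e := zpow_add₀ (by norm_num) _ _
        _ ≤ _ := mul_le_mul_of_nonneg_left (he1.le.trans h2) (by positivity)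
    · intro j hj
      by_cases hjb : b ≤ |x j|
      · simp only [if_pos hjb]
        exact ⟨hjb, (hmax j (Finset.mem_univ j)).trans he2⟩
      · simp [hjb] at hj

end SHOFA

/-! ### Choice of the constants -/

theorem theorem1 (d : ℕ) (hd : 7 ≤ d) :
    ∃ c : ℕ, 0 < c ∧ ∀ κ : ℕ, ∃ (K T : ℕ) (C : ℝ), 0 < C ∧
      ∀ n k P : ℕ, 2 ≤ n → 1 ≤ k → k ≤ n →
      ∀ pick : ℕ → Finset (Fin (c * k)) → Fin (c * k),
        (∀ t L, L.Nonempty → pick t L ∈ L) →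
        -- exact arithmetic
        (∀ x : Fin n → ℝ, SHOFA.Sparse k x →
          1 - C / k ≤ SHOFA.prob {ω : SHOFA.Design n (c * k) d (3 * Nat.clog 2 k) |
            (SHOFA.decode SHOFA.exact ω pick k (SHOFA.measure ω x)).val = x}) ∧
        -- finite precision
        (∀ (x x' : Fin n → ℝ) (e : ℤ), SHOFA.Sparse k x →
          SHOFA.Represents k P (κ * (Nat.clog 2 n + P)) e x x' →
          1 - C / k ≤ SHOFA.prob {ω : SHOFA.Design n (c * k) d (3 * Nat.clog 2 k) |
            SHOFA.l1 (x - (2 : ℝ) ^ e •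
              (SHOFA.decode
                (SHOFA.fixedPoint (K * (Nat.clog 2 n + P)) (T * (Nat.clog 2 n + P)))
                ω pick k ((2 : ℂ) ^ (-e) • SHOFA.measure ω x')).val)
              ≤ (2 : ℝ) ^ (-(P : ℤ)) * SHOFA.l1 x}) ∧
        -- every signal has a finite-precision representation
        (3 ≤ κ → ∀ x : Fin n → ℝ, SHOFA.Sparse k x →
          ∃ (x' : Fin n → ℝ) (e : ℤ),
            SHOFA.Represents k P (κ * (Nat.clog 2 n + P)) e x x') ∧
        -- numbers of steps and of bit operations
        (∀ (ω : SHOFA.Design n (c * k) d (3 * Nat.clog 2 k)) (y : Fin (c * k) × Fin 2 → ℂ),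
          ((SHOFA.decode SHOFA.exact ω pick k y).steps : ℝ) ≤ C * k ∧
          ((SHOFA.decode
            (SHOFA.fixedPoint (K * (Nat.clog 2 n + P)) (T * (Nat.clog 2 n + P)))
            ω pick k y).steps : ℝ) ≤ C * k ∧
          ((SHOFA.decode
            (SHOFA.fixedPoint (K * (Nat.clog 2 n + P)) (T * (Nat.clog 2 n + P)))
            ω pick k y).steps : ℝ) *
              SHOFA.wordBits (K * (Nat.clog 2 n + P)) n (c * k)
            ≤ C * (k * (Real.logb 2 n + P))) := by
  refine ⟨100 * d ^ 2, by positivity, fun κ => ?_⟩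
  set c := 100 * d ^ 2 with hc
  -- The constant dominates separately the failure constant `2 + 2 c`, the step constant, and the
  -- product of the step constant with the word length constant.
  refine ⟨2 * κ + 27, κ + 7,
    (2 + 2 * c) + (31 * c + 35 + 37 * d) * (1 + (8 * (2 * κ + 27) + 8 + c)), by positivity, ?_⟩
  intro n k P hn hk hkn pick hpick
  set C : ℝ := (2 + 2 * c) + (31 * c + 35 + 37 * d) * (1 + (8 * (2 * κ + 27) + 8 + c)) with hC
  have hk' : (0 : ℝ) < k := by exact_mod_cast hk
  have hprob : 1 - C / k ≤ 1 - (2 + 2 * c : ℝ) / k := by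
    have : (2 + 2 * c : ℝ) ≤ C := by
      rw [hC]
      exact le_add_of_nonneg_right (by positivity)
    have := div_le_div_of_nonneg_right this hk'.le
    linarith
  have hsteps : ∀ (ar : SHOFA.Arith) (ω : SHOFA.Design n (c * k) d (3 * Nat.clog 2 k))
      (y : Fin (c * k) × Fin 2 → ℂ),
      ((SHOFA.decode ar ω pick k y).steps : ℝ) ≤ (31 * c + 35 + 37 * d) * k := by
    intro ar ω y
    have h : ((SHOFA.decode ar ω pick k y).steps : ℝ) ≤
        ((c * k * 31 + k * (35 + 37 * d) : ℕ) : ℝ) := by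
      exact_mod_cast SHOFA.steps_decode_le ar ω pick k y
    push_cast at h
    linarith
  have hC1 : (31 * c + 35 + 37 * d : ℝ) * k ≤ C * k := by
    refine mul_le_mul_of_nonneg_right ?_ hk'.le
    rw [hC, mul_add, mul_one]
    have h1 : (0 : ℝ) ≤ (31 * c + 35 + 37 * d) * (8 * (2 * κ + 27) + 8 + c) := by positivity
    have h2 : (0 : ℝ) ≤ 2 + 2 * c := by positivity
    linarith
  refine ⟨fun x hx => hprob.trans (SHOFA.le_prob_decode_exact hd le_rfl hn hk hkn hpick hx),
    fun x x' e _ hx' => hprob.trans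
      (SHOFA.le_prob_decode_fixedPoint hd le_rfl hn hk hkn hpick κ P hx'),
    fun hκ x hx => SHOFA.exists_represents hn hκ P hx,
    fun ω y => ⟨(hsteps _ ω y).trans hC1, (hsteps _ ω y).trans hC1, ?_⟩⟩
  have hw := SHOFA.wordBits_le (c := c) (P := P) hn hkn (2 * κ + 27)
  push_cast at hw
  refine (mul_le_mul (hsteps _ ω y) hw (Nat.cast_nonneg _) (by positivity)).trans ?_
  have hlog : 0 ≤ Real.logb 2 n + P := by
    have : 0 ≤ Real.logb 2 n := Real.logb_nonneg (by norm_num) (by exact_mod_cast (by omega : 1 ≤ n))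
    positivity
  have hCge : (31 * c + 35 + 37 * d : ℝ) * (8 * (2 * κ + 27) + 8 + c) ≤ C := by
    rw [hC, mul_add _ (1 : ℝ), mul_one]
    have h1 : (0 : ℝ) ≤ 31 * c + 35 + 37 * d := by positivity
    have h2 : (0 : ℝ) ≤ 2 + 2 * c := by positivity
    linarith
  calc _ = ((31 * c + 35 + 37 * d : ℝ) * (8 * (2 * κ + 27) + 8 + c)) *
        (k * (Real.logb 2 n + P)) := by ring
    _ ≤ _ := mul_le_mul_of_nonneg_right hCge (by positivity)
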